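/- Let $d,T\ge 1$ be integers, $X\subset\mathbb R^d$ nonempty, closed and convex with $\|x-y\|_\infty\le D_\infty$ for all $x,y\in X$, $x_0\in X$, and $q\in\mathbb R^d$ with $0<q_i\le q_{\max}$. Let $(\Omega,\mathcal F,P)$ be a probability space, $F:\mathbb R^d\times\Omega\to\mathbb R$ measurable, $F(x,\cdot)$ integrable and $f(x)=\mathbb E_\xi[F(x,\xi)]$ for all $x$. Let $\rho>0$ and assume that $f$ is $(\rho,Q)$-weakly convex with $Q=\mathrm{diag}(\sqrt{q_1},\dots,\sqrt{q_d})$, i.e. $x\mapsto f(x)+\frac\rho2\|Q^{1/2}x\|^2$ is convex. Let $0\le\beta_1<1$, $0<\beta_2<1$, $0\le\beta_3<1$, $\beta_1/\sqrt{\beta_2}<1$, $\pi\in(0,1)$, $\alpha>0$, and put $$\beta_{1,t}=\beta_1\pi^{t-1}\ (t\ge1),\qquad \beta_{1,0}\in[0,1)\text{ arbitrary},\qquad \mu=\frac d{\sqrt{T+1}},\qquad \alpha_t=\frac{\alpha}{\sqrt{T+1}} .$$ Assume that for every $\xi\in\Omega$ the function $F(\cdot,\xi)$ is $L_F$-Lipschitz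 (Euclidean norm, $L_F\ge0$) on the closed $\mu$-neighbourhood $\{x:\mathrm{dist}(x,X)\le\mu\}$ of $X$. Projected ZEMA: let $(\xi_t,u_t)$, $t=0,1,\dots$, be i.i.d. with law $P\otimes\mathrm{Unif}(B)$, $B$ the unit Euclidean ball. Set $m_{-1}=v_{-1}=0$, $\hat v_{-1}=q$, and for $t=0,\dots,T$ (vector operations are coordinatewise) $$g_t=\tfrac d\mu\,[F(x_t+\mu u_t,\xi_t)-F(x_t,\xi_t)]\,u_t,\qquad m_t=\beta_{1,t}m_{t-1}+(1-\beta_{1,t})g_t,\qquad v_t=\beta_2v_{t-1}+(1-\beta_2)g_t^2,$$ $$\hat v_t=\beta_3\hat v_{t-1}+(1-\beta_3)\max(\hat v_{t-1},v_t),\qquad \hat V_t=\mathrm{diag}(\hat v_t),\qquad x_{t+1}=\arg\min_{y\in X}\big\|\hat V_t^{1/4}\big(x_t-\alpha_t\hat V_t^{-1/2}m_t-y\big)\big\|^2 .$$ The output is $x_{t^*}$, where $t^*$ is independent of the samples and $\mathbb P(t^*=t)=\alpha_t/\sum_{s=0}^T\alpha_s$ for $t=0,\dots,T$. For a positive diagonal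 matrix $W$ let $$\psi_{1/(2\rho),W}(x)=\min_{y\in X}\{f(y)+\rho\|W^{1/2}(x-y)\|^2\}$$ be the scaled Moreau envelope of $\psi=f+\delta_X$ with parameter $1/\bar\rho$, $\bar\rho=2\rho$. Then $\psi_{1/(2\rho),\hat V_{t^*}^{1/2}}$ is differentiable at $x_{t^*}$, and there is a constant $C>0$ that depends only on $\rho,L_F,D_\infty,\beta_1,\beta_2,\beta_3,\pi,\alpha,q_{\max}$ (not on $d$, $T$, $X$, $x_0$, $q$, $\beta_{1,0}$, $P$, $F$) such that the squared gradient norm in the norm dual to that of $\hat V_{t^*}^{1/2}$ satisfies $$\mathbb E\Big[\big\|\hat V_{t^*}^{-1/4}\,\nabla\psi_{1/(2\rho),\hat V_{t^*}^{1/2}}(x_{t^*})\big\|^2\Big]\le C\,\frac{d^2}{\sqrt T},$$ and the Euclidean one satisfies $$\mathbb E\Big[\big\|\nabla\psi_{1/(2\rho),\hat V_{t^*}^{1/2}}(x_{t^*})\big\|^2\Big]\le C\,\max\{\sqrt{q_{\max}},\,d L_F\}\,\frac{d^2}{\sqrt T}.$$ In particular, for each fixed problem both expectations are $O(d^2/\sqrt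 T)$ as $T$ varies. Both expectations are of integrable random variables. -/

import Mathlib

open MeasureTheory ProbabilityTheory

noncomputable section

namespace Zema

/-- For a positive diagonal matrix `Q = diag(w)`: the squared scaled norm
`‖Q^{1/2} z‖² = ∑ i, w i * (z i)²`. -/
def diagNormSq {d : ℕ} (w : Fin d → ℝ) (z : EuclideanSpace ℝ (Fin d)) : ℝ :=
  ∑ i, w i * (z i) ^ 2

/-- `f` is `(ρ, diag(w))`-weakly convex: `x ↦ f x + (ρ/2) ‖diag(w)^{1/2} x‖²` is convex. -/
def WeaklyConvex {d : ℕ} (ρ : ℝ) (w : Fin d → ℝ) (f : EuclideanSpace ℝ (Fin d) → ℝ) : Prop :=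
  ConvexOn ℝ Set.univ (fun x => f x + ρ / 2 * diagNormSq w x)

/-- The scaled Moreau envelope `ψ_{ζ,Q}(x) = min_y {ψ y + (1/(2ζ)) ‖Q^{1/2}(x - y)‖²}` of
`ψ = f + (indicator of X)`, with `Q = diag(w)`. The indicator is `+∞` off `X`, so the minimum is
over `y ∈ X`. -/
def envelope {d : ℕ} (X : Set (EuclideanSpace ℝ (Fin d))) (f : EuclideanSpace ℝ (Fin d) → ℝ)
    (ζ : ℝ) (w : Fin d → ℝ) (x : EuclideanSpace ℝ (Fin d)) : ℝ :=
  ⨅ y : X, (f (y : EuclideanSpace ℝ (Fin d)) + 1 / (2 * ζ) * diagNormSq w (x - y))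

/-- `p` is a point of `argmin_{y ∈ X} ‖Q^{1/2}(z - y)‖²`, with `Q = diag(w)`. -/
def IsProj {d : ℕ} (X : Set (EuclideanSpace ℝ (Fin d))) (w : Fin d → ℝ)
    (z p : EuclideanSpace ℝ (Fin d)) : Prop :=
  p ∈ X ∧ ∀ y ∈ X, diagNormSq w (z - p) ≤ diagNormSq w (z - y)

/-- The scaled projection `Π_{X,Q}[z]`, with `Q = diag(w)`. For `X` nonempty, closed and convex and
`w > 0` there is exactly one point with `IsProj X w z`, and this is it. -/
def proj {d : ℕ} (X : Set (EuclideanSpace ℝ (Fin d))) (w : Fin d → ℝ)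
    (z : EuclideanSpace ℝ (Fin d)) : EuclideanSpace ℝ (Fin d) :=
  Classical.epsilon (IsProj X w z)

/-- The uniform distribution on the closed unit Euclidean ball of `ℝ^d`. -/
def ballUniform (d : ℕ) : Measure (EuclideanSpace ℝ (Fin d)) :=
  cond volume (Metric.closedBall 0 1)

/-- The two-point estimator `G_μ(x, ξ, u) = (d/μ) [F(x + μ u, ξ) - F(x, ξ)] u`. -/
def estimator {d : ℕ} {Ω : Type*} (F : EuclideanSpace ℝ (Fin d) → Ω → ℝ) (μ : ℝ)
    (x : EuclideanSpace ℝ (Fin d)) (ξ : Ω) (u : EuclideanSpace ℝ (Fin d)) :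
    EuclideanSpace ℝ (Fin d) :=
  ((d : ℝ) / μ * (F (x + μ • u) ξ - F x ξ)) • u

/-- What the method carries from one iteration to the next: at the start of iteration `t` it holds
`x_t`, `m_{t-1}`, `v_{t-1}` and `v̂_{t-1}`. -/
structure State (d : ℕ) where
  x : EuclideanSpace ℝ (Fin d)
  m : EuclideanSpace ℝ (Fin d)
  v : Fin d → ℝ
  vhat : Fin d → ℝ

/-- The momentum update `β₁ m + (1 - β₁) g`. -/
def nextM {d : ℕ} (β₁ : ℝ) (m g : EuclideanSpace ℝ (Fin d)) : EuclideanSpace ℝ (Fin d) :=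
  β₁ • m + (1 - β₁) • g

/-- The second moment update `β₂ v + (1 - β₂) g²`, coordinatewise. -/
def nextV {d : ℕ} (β₂ : ℝ) (v : Fin d → ℝ) (g : EuclideanSpace ℝ (Fin d)) : Fin d → ℝ :=
  fun i => β₂ * v i + (1 - β₂) * (g i) ^ 2

/-- The scaling update `β₃ v̂ + (1 - β₃) max(v̂, v)`, coordinatewise. -/
def nextVhat {d : ℕ} (β₃ : ℝ) (vhat v : Fin d → ℝ) : Fin d → ℝ :=
  fun i => β₃ * vhat i + (1 - β₃) * max (vhat i) (v i)

/-- The iterate update `Π_{X, V̂^{1/2}}[x - α V̂^{-1/2} m]`, where `V̂ = diag(vhat)`. -/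
def nextX {d : ℕ} (X : Set (EuclideanSpace ℝ (Fin d))) (α : ℝ) (vhat : Fin d → ℝ)
    (x m : EuclideanSpace ℝ (Fin d)) : EuclideanSpace ℝ (Fin d) :=
  proj X (fun i => √(vhat i)) (x - WithLp.toLp 2 (fun i => α * ((√(vhat i))⁻¹ * m i)))

/-- One iteration of projected ZEMA with momentum parameter `β₁` and step size `α`, on the sample
`ξ` and the random direction `u`. -/
def step {d : ℕ} {Ω : Type*} (X : Set (EuclideanSpace ℝ (Fin d)))
    (F : EuclideanSpace ℝ (Fin d) → Ω → ℝ) (μ α β₁ β₂ β₃ : ℝ)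
    (s : State d) (ξ : Ω) (u : EuclideanSpace ℝ (Fin d)) : State d :=
  let g := estimator F μ s.x ξ u
  let m := nextM β₁ s.m g
  let v := nextV β₂ s.v g
  let vhat := nextVhat β₃ s.vhat v
  { x := nextX X α vhat s.x m, m := m, v := v, vhat := vhat }

/-- Projected ZEMA with smoothing parameter `μ`, step sizes `α t` and momentum parameters `β₁ t`,
started at `x₀` with `m_{-1} = v_{-1} = 0` and `v̂_{-1} = q`, on the samples `ξ t` and the
directions `u t`. `run … t` is the state at the start of iteration `t`. -/
def run {d : ℕ} {Ω : Type*} (X : Set (EuclideanSpace ℝ (Fin d)))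
    (F : EuclideanSpace ℝ (Fin d) → Ω → ℝ) (μ : ℝ) (α β₁ : ℕ → ℝ) (β₂ β₃ : ℝ)
    (x₀ : EuclideanSpace ℝ (Fin d)) (q : Fin d → ℝ)
    (ξ : ℕ → Ω) (u : ℕ → EuclideanSpace ℝ (Fin d)) : ℕ → State d
  | 0 => { x := x₀, m := 0, v := 0, vhat := q }
  | t + 1 => step X F μ (α t) (β₁ t) β₂ β₃ (run X F μ α β₁ β₂ β₃ x₀ q ξ u t) (ξ t) (u t)

/-- The iterate `x_t`. -/
def iterate {d : ℕ} {Ω : Type*} (X : Set (EuclideanSpace ℝ (Fin d)))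
    (F : EuclideanSpace ℝ (Fin d) → Ω → ℝ) (μ : ℝ) (α β₁ : ℕ → ℝ) (β₂ β₃ : ℝ)
    (x₀ : EuclideanSpace ℝ (Fin d)) (q : Fin d → ℝ)
    (ξ : ℕ → Ω) (u : ℕ → EuclideanSpace ℝ (Fin d)) (t : ℕ) : EuclideanSpace ℝ (Fin d) :=
  (run X F μ α β₁ β₂ β₃ x₀ q ξ u t).x

/-- The diagonal of `V̂_t^{1/2}`; the vector `v̂_t` is computed in iteration `t`. -/
def scaling {d : ℕ} {Ω : Type*} (X : Set (EuclideanSpace ℝ (Fin d)))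
    (F : EuclideanSpace ℝ (Fin d) → Ω → ℝ) (μ : ℝ) (α β₁ : ℕ → ℝ) (β₂ β₃ : ℝ)
    (x₀ : EuclideanSpace ℝ (Fin d)) (q : Fin d → ℝ)
    (ξ : ℕ → Ω) (u : ℕ → EuclideanSpace ℝ (Fin d)) (t : ℕ) : Fin d → ℝ :=
  fun i => √((run X F μ α β₁ β₂ β₃ x₀ q ξ u (t + 1)).vhat i)

/-- The randomness of the method: the pairs `(ξ t, u t)` are independent and identically
distributed with law `P ⊗ (uniform on the unit ball)`; the output index `tstar` is independent of
all of them, and `tstar = t` has probability `α t / ∑_{s ≤ T} α s` for `t ∈ {0, …, T}`. -/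
structure Sampling {d : ℕ} {Ω : Type*} [MeasurableSpace Ω] (P : Measure Ω) (T : ℕ) (α : ℕ → ℝ)
    {S : Type*} [MeasurableSpace S] (Pr : Measure S)
    (ξ : ℕ → S → Ω) (u : ℕ → S → EuclideanSpace ℝ (Fin d)) (tstar : S → ℕ) : Prop where
  measurable_ξ : ∀ t, Measurable (ξ t)
  measurable_u : ∀ t, Measurable (u t)
  measurable_tstar : Measurable tstar
  law : ∀ t, Pr.map (fun ω => (ξ t ω, u t ω)) = P.prod (ballUniform d)
  indep : iIndepFun (fun t ω => (ξ t ω, u t ω)) Pr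
  law_tstar : ∀ t ∈ Finset.range (T + 1),
    Pr.real {ω | tstar ω = t} = α t / ∑ s ∈ Finset.range (T + 1), α s
  indep_tstar : IndepFun tstar (fun ω t => (ξ t ω, u t ω)) Pr

end Zema

end

/-!
The gradient of the scaled Moreau envelope at `x` is `2ρ W (x - p)`, where `p` is the scaled proximal
point of `x` (`hasGradientAt_envelope`), so the squared dual norm of the gradient is `4ρ²` times the
squared scaled distance `gap` from `x` to `p`. The task is to bound the average of the gaps along
the run.

The difficulty is that the scaling `V̂_t` of iteration `t` depends on the current sample. The descent
argument therefore uses the proximal point `y_t` of `x_t` for the scaling of the previous iteration,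
which is independent of that sample. Since the scalings only grow, changing from one scaling to the
next costs at most a constant times `D²` times the increase of the trace of `V̂^{1/2}`, both in the
envelope (`envelope_step`) and in the gap (`IsProx.diagNormSq_le_of_le`). These costs telescope, and
the trace is at most `d max(√q_max, d L)`. This is one source of the factor `d²`.

*Deterministic part.* The projection does not increase scaled distances to `y_t`, so one step changes
the envelope by `-2ρα_t ⟨m_t, x_t - y_t⟩` up to the second order term `ρα_t² ∑ m_i² / √v̂_i`. The
latter is bounded without a lower bound on `q`, because `|m_i| ≤ const · √v_i` when
`β₁ / √β₂ < 1` (`Trajectory.abs_m_le`). Replacing `m_t` by the estimate `g_t` costs a multiple of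
`β_{1,t}`, which is summable. Summation gives a deterministic bound on `∑ ⟨g_t, x_t - y_t⟩`
(`Trajectory.sum_inner_le`).

*Stochastic part.* For `u` uniform in the ball, the mean of `h(u) u` is the gradient at `0` of the
smoothing of `h` by the kernel `(1 - ‖u‖²)⁺ / 2`, since the gradient of this kernel is `-u` on the ball. If `h`
is convex then so is its smoothing, which yields the gradient inequality `integral_mul_inner_le`.
Applied to `f` plus a quadratic, it bounds the conditional expectation of `⟨g_t, x_t - y_t⟩` from
below by a multiple of the gap at `y_t`, up to an error of order `d L μ`
(`IsOracle.le_integral_inner_estimator`); the factor is of order one because the kernel has mass of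
order `1 / d` (`le_integral_kernel`).

Together these bound the sum of the expected gaps (`sum_integral_gap_le`), and the independent
uniform output index turns the sum into an average (`integral_random_index`). The Euclidean bound
follows because the weights are almost surely at most `max(√q_max, d L)`.
-/

noncomputable section

open Filter Topology

namespace Zema

/-! ### Weighted squared norms -/

section Weighted

variable {d : ℕ}

lemma diagNormSq_nonneg {w : Fin d → ℝ} (hw : ∀ i, 0 ≤ w i) (z : EuclideanSpace ℝ (Fin d)) :
    0 ≤ diagNormSq w z :=
  Finset.sum_nonneg fun i _ => mul_nonneg (hw i) (sq_nonneg _)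

lemma diagNormSq_mono {w w' : Fin d → ℝ} (h : ∀ i, w i ≤ w' i) (z : EuclideanSpace ℝ (Fin d)) :
    diagNormSq w z ≤ diagNormSq w' z :=
  Finset.sum_le_sum fun i _ => mul_le_mul_of_nonneg_right (h i) (sq_nonneg _)

lemma diagNormSq_sub_comm (w : Fin d → ℝ) (x y : EuclideanSpace ℝ (Fin d)) :
    diagNormSq w (x - y) = diagNormSq w (y - x) := by
  unfold diagNormSq
  refine Finset.sum_congr rfl fun i _ => ?_
  simp only [PiLp.sub_apply]
  ring

/-- Increasing the weights raises the squared norm of a vector with entries at most `D` by at most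
`D²` times the total increase. -/
lemma diagNormSq_le_add {w w' : Fin d → ℝ} (h : ∀ i, w i ≤ w' i) {D : ℝ}
    {z : EuclideanSpace ℝ (Fin d)} (hz : ∀ i, |z i| ≤ D) :
    diagNormSq w' z ≤ diagNormSq w z + D ^ 2 * (∑ i, w' i - ∑ i, w i) := by
  unfold diagNormSq
  rw [← Finset.sum_sub_distrib, Finset.mul_sum, ← Finset.sum_add_distrib]
  refine Finset.sum_le_sum fun i _ => ?_
  have h1 : (z i) ^ 2 ≤ D ^ 2 := sq_le_sq' (by linarith [neg_abs_le (z i), hz i])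
    ((le_abs_self _).trans (hz i))
  nlinarith [h i]

lemma diagNormSq_pos {w : Fin d → ℝ} (hw : ∀ i, 0 < w i) {z : EuclideanSpace ℝ (Fin d)}
    (hz : z ≠ 0) : 0 < diagNormSq w z := by
  obtain ⟨i, hi⟩ : ∃ i, z i ≠ 0 := by
    by_contra! h
    exact hz (PiLp.ext h)
  exact Finset.sum_pos' (fun i _ => mul_nonneg (hw i).le (sq_nonneg _))
    ⟨i, Finset.mem_univ i, mul_pos (hw i) (by positivity)⟩

lemma continuous_diagNormSq :
    Continuous fun p : (Fin d → ℝ) × EuclideanSpace ℝ (Fin d) => diagNormSq p.1 p.2 := by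
  unfold diagNormSq
  fun_prop

lemma diagNormSq_segment (w : Fin d → ℝ) (x p y : EuclideanSpace ℝ (Fin d)) (θ : ℝ) :
    diagNormSq w (x - ((1 - θ) • p + θ • y)) =
      (1 - θ) * diagNormSq w (x - p) + θ * diagNormSq w (x - y)
        - θ * (1 - θ) * diagNormSq w (p - y) := by
  unfold diagNormSq
  simp only [Finset.mul_sum, ← Finset.sum_add_distrib, ← Finset.sum_sub_distrib]
  refine Finset.sum_congr rfl fun i _ => ?_
  simp only [PiLp.sub_apply, PiLp.add_apply, PiLp.smul_apply, smul_eq_mul]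
  ring

lemma diagNormSq_le_mul_norm_sq {w : Fin d → ℝ} {M : ℝ} (h : ∀ i, w i ≤ M)
    (z : EuclideanSpace ℝ (Fin d)) : diagNormSq w z ≤ M * ‖z‖ ^ 2 := by
  rw [EuclideanSpace.real_norm_sq_eq, Finset.mul_sum]
  exact Finset.sum_le_sum fun i _ => mul_le_mul_of_nonneg_right (h i) (sq_nonneg _)

lemma norm_sq_le_mul_diagNormSq_inv {w : Fin d → ℝ} (hw : ∀ i, 0 < w i) {M : ℝ}
    (h : ∀ i, w i ≤ M) (z : EuclideanSpace ℝ (Fin d)) :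
    ‖z‖ ^ 2 ≤ M * diagNormSq (fun i => (w i)⁻¹) z := by
  rw [EuclideanSpace.real_norm_sq_eq, diagNormSq, Finset.mul_sum]
  refine Finset.sum_le_sum fun i _ => ?_
  rw [← mul_assoc]
  refine le_mul_of_one_le_left (sq_nonneg _) ?_
  rw [← div_eq_mul_inv, one_le_div (hw i)]
  exact h i

/-- `‖a + b‖² ≤ 2‖a‖² + 2‖b‖²`, for `a = x - y` and `b = y - z`. -/
lemma diagNormSq_sub_le {w : Fin d → ℝ} (hw : ∀ i, 0 ≤ w i) (x y z : EuclideanSpace ℝ (Fin d)) :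
    diagNormSq w (x - z) ≤ 2 * diagNormSq w (x - y) + 2 * diagNormSq w (y - z) := by
  unfold diagNormSq
  rw [Finset.mul_sum, Finset.mul_sum, ← Finset.sum_add_distrib]
  refine Finset.sum_le_sum fun i _ => ?_
  simp only [PiLp.sub_apply]
  nlinarith [mul_nonneg (hw i) (sq_nonneg ((x i - y i) - (y i - z i)))]

end Weighted

/-! ### Scaled proximal points -/

section Prox

variable {d : ℕ} {X : Set (EuclideanSpace ℝ (Fin d))} {f : EuclideanSpace ℝ (Fin d) → ℝ}

/-- `p` minimises `y ↦ f y + c ‖W^{1/2}(x - y)‖²` over `X`, where `W = diag(w)`. -/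
def IsProx (X : Set (EuclideanSpace ℝ (Fin d))) (f : EuclideanSpace ℝ (Fin d) → ℝ) (c : ℝ)
    (w : Fin d → ℝ) (x p : EuclideanSpace ℝ (Fin d)) : Prop :=
  p ∈ X ∧ ∀ y ∈ X, f p + c * diagNormSq w (x - p) ≤ f y + c * diagNormSq w (x - y)

/-- The scaled proximal point: a minimiser of `y ↦ f y + c ‖W^{1/2}(x - y)‖²` over `X`, where
`W = diag(w)`. -/
def prox (X : Set (EuclideanSpace ℝ (Fin d))) (f : EuclideanSpace ℝ (Fin d) → ℝ) (c : ℝ)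
    (w : Fin d → ℝ) (x : EuclideanSpace ℝ (Fin d)) : EuclideanSpace ℝ (Fin d) :=
  Classical.epsilon (IsProx X f c w x)

/-- The scaled projection is the scaled proximal point of the zero function. -/
lemma proj_eq_prox (w : Fin d → ℝ) (z : EuclideanSpace ℝ (Fin d)) :
    proj X w z = prox X (fun _ => 0) 1 w z := by
  unfold proj prox
  congr 1
  funext p
  simp [IsProj, IsProx]

lemma isProx_prox (hX : IsCompact X) (hne : X.Nonempty) (hf : Continuous f) (c : ℝ)
    (w : Fin d → ℝ) (x : EuclideanSpace ℝ (Fin d)) : IsProx X f c w x (prox X f c w x) := by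
  refine Classical.epsilon_spec (p := IsProx X f c w x) ?_
  have hc : Continuous fun y => f y + c * diagNormSq w (x - y) :=
    hf.add (continuous_const.mul (continuous_diagNormSq.comp
      (continuous_const.prodMk (continuous_const.sub continuous_id))))
  obtain ⟨p, hp, hmin⟩ := hX.exists_isMinOn hne hc.continuousOn
  exact ⟨p, hp, fun y hy => hmin hy⟩

lemma WeaklyConvex.segment_le {ρ : ℝ} {κ : Fin d → ℝ} (hf : WeaklyConvex ρ κ f)
    (p y : EuclideanSpace ℝ (Fin d)) {θ : ℝ} (h0 : 0 ≤ θ) (h1 : θ ≤ 1) :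
    f ((1 - θ) • p + θ • y) ≤
      (1 - θ) * f p + θ * f y + ρ / 2 * (θ * (1 - θ) * diagNormSq κ (p - y)) := by
  have h := hf.2 (Set.mem_univ p) (Set.mem_univ y) (sub_nonneg.2 h1) h0 (by ring)
  simp only [smul_eq_mul] at h
  have h2 := diagNormSq_segment κ 0 p y θ
  have h3 : ∀ z : EuclideanSpace ℝ (Fin d), diagNormSq κ (0 - z) = diagNormSq κ z := fun z => by
    rw [diagNormSq_sub_comm, sub_zero]
  rw [h3, h3, h3] at h2
  rw [h2] at h
  linarith

lemma weaklyConvex_zero : WeaklyConvex 0 0 (fun _ : EuclideanSpace ℝ (Fin d) => (0 : ℝ)) := by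
  simpa [WeaklyConvex] using convexOn_const (0 : ℝ) convex_univ

/-- Weak convexity is convexity after adding a squared norm centred anywhere. -/
lemma WeaklyConvex.convexOn_add {ρ : ℝ} {κ : Fin d → ℝ} (hf : WeaklyConvex ρ κ f)
    (x : EuclideanSpace ℝ (Fin d)) :
    ConvexOn ℝ Set.univ fun y => f y + ρ / 2 * diagNormSq κ (x - y) := by
  refine ⟨convex_univ, fun p _ y _ a b ha hb hab => ?_⟩
  obtain rfl : a = 1 - b := by linarith
  have h1 := hf.segment_le p y hb (by linarith)
  have h2 := diagNormSq_segment κ x p y b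
  simp only [smul_eq_mul]
  rw [h2]
  linarith

lemma WeaklyConvex.continuous {ρ : ℝ} {κ : Fin d → ℝ} (hf : WeaklyConvex ρ κ f) :
    Continuous f := by
  have h := (ConvexOn.locallyLipschitz hf).continuous
  have h2 : Continuous fun x : EuclideanSpace ℝ (Fin d) => ρ / 2 * diagNormSq κ x :=
    continuous_const.mul (continuous_diagNormSq.comp (continuous_const.prodMk continuous_id))
  exact (h.sub h2).congr fun x => by simp

/-- The objective of the proximal problem grows quadratically around its minimiser. -/
lemma IsProx.growth {ρ c : ℝ} {κ w : Fin d → ℝ} (hf : WeaklyConvex ρ κ f) (hX : Convex ℝ X)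
    {x p y : EuclideanSpace ℝ (Fin d)} (hp : IsProx X f c w x p) (hy : y ∈ X) :
    f p + c * diagNormSq w (x - p) + (c * diagNormSq w (p - y) - ρ / 2 * diagNormSq κ (p - y))
      ≤ f y + c * diagNormSq w (x - y) := by
  set M := c * diagNormSq w (p - y) - ρ / 2 * diagNormSq κ (p - y) with hM
  -- compare `p` with the points `(1 - θ) p + θ y`, divide by `θ` and let `θ → 0`
  have key : ∀ θ : ℝ, 0 < θ → θ ≤ 1 →
      f p + c * diagNormSq w (x - p) + (1 - θ) * M ≤ f y + c * diagNormSq w (x - y) := by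
    intro θ h0 h1
    have h2 := hp.2 _ (hX hp.1 hy (sub_nonneg.2 h1) h0.le (by ring))
    have h3 := hf.segment_le p y h0.le h1
    rw [diagNormSq_segment] at h2
    have h4 : 0 ≤ θ * (f y + c * diagNormSq w (x - y)
        - (f p + c * diagNormSq w (x - p) + (1 - θ) * M)) := by
      rw [hM]; linarith
    have := nonneg_of_mul_nonneg_right h4 h0
    linarith
  have hlim : Tendsto (fun θ : ℝ => f p + c * diagNormSq w (x - p) + (1 - θ) * M) (𝓝[>] 0)
      (𝓝 (f p + c * diagNormSq w (x - p) + (1 - 0) * M)) := by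
    refine Tendsto.mono_left (Continuous.tendsto ?_ 0) nhdsWithin_le_nhds
    fun_prop
  rw [sub_zero, one_mul] at hlim
  refine le_of_tendsto hlim ?_
  filter_upwards [Ioc_mem_nhdsGT (zero_lt_one' ℝ)] with θ hθ using key θ hθ.1 hθ.2

/-- Minimisers over a compact set depend continuously on the parameter when they are unique. -/
lemma continuous_of_unique_argmin {A E : Type*} [TopologicalSpace A] [TopologicalSpace E]
    {K : Set E} (hK : IsCompact K) {J : A → E → ℝ} (hJ : Continuous (Function.uncurry J))
    {m : A → E} (hm : ∀ a, m a ∈ K) (hmin : ∀ a, ∀ y ∈ K, J a (m a) ≤ J a y)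
    (huniq : ∀ a, ∀ p ∈ K, (∀ y ∈ K, J a p ≤ J a y) → p = m a) : Continuous m := by
  rw [continuous_iff_continuousAt]
  intro a₀
  refine hK.tendsto_nhds_of_unique_mapClusterPt (Eventually.of_forall hm) fun p hp hcl => ?_
  refine huniq a₀ p hp fun z hz => ?_
  by_contra! hlt
  have hJz : Continuous fun q : A × E => J q.1 z :=
    hJ.comp (continuous_fst.prodMk continuous_const)
  have hopen : {q : A × E | J q.1 z < J q.1 q.2} ∈ 𝓝 (a₀, p) :=
    (isOpen_lt hJz hJ).mem_nhds hlt
  rw [nhds_prod_eq] at hopen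
  obtain ⟨U, hU, V, hV, hUV⟩ := Filter.mem_prod_iff.1 hopen
  obtain ⟨a, haV, haU⟩ := ((hcl.frequently (p := (· ∈ V)) hV).and_eventually hU).exists
  exact absurd (hmin a z hz) (not_le.2 (hUV (Set.mk_mem_prod haU haV)))

/-- A proximal problem with `ρ κ < 2 c w` has one minimiser. -/
lemma IsProx.unique {ρ c : ℝ} {κ w : Fin d → ℝ} (hf : WeaklyConvex ρ κ f) (hX : Convex ℝ X)
    (hw : ∀ i, 0 < c * w i - ρ / 2 * κ i) {x p p' : EuclideanSpace ℝ (Fin d)}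
    (hp : IsProx X f c w x p) (hp' : IsProx X f c w x p') : p = p' := by
  by_contra hne
  have h1 := hp.growth hf hX hp'.1
  have h2 := hp'.2 p hp.1
  have h3 := diagNormSq_pos hw (sub_ne_zero.2 hne)
  have h4 : diagNormSq (fun i => c * w i - ρ / 2 * κ i) (p - p') =
      c * diagNormSq w (p - p') - ρ / 2 * diagNormSq κ (p - p') := by
    simp only [diagNormSq, Finset.mul_sum, ← Finset.sum_sub_distrib]
    exact Finset.sum_congr rfl fun i _ => by ring
  linarith

/-- The proximal point depends continuously on the scaling and the centre. The scaling is cut off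
from below at `κ`, so that the map is defined and continuous on the whole space. -/
lemma continuous_prox {ρ c : ℝ} {κ : Fin d → ℝ} (hf : WeaklyConvex ρ κ f) (hX : Convex ℝ X)
    (hXc : IsCompact X) (hne : X.Nonempty) (hc : 0 ≤ c) {b : Fin d → ℝ}
    (hκ : ∀ i, 0 < c * b i - ρ / 2 * κ i) :
    Continuous fun p : (Fin d → ℝ) × EuclideanSpace ℝ (Fin d) =>
      prox X f c (fun i => max (p.1 i) (b i)) p.2 := by
  have hspec := fun p : (Fin d → ℝ) × EuclideanSpace ℝ (Fin d) =>
    isProx_prox hXc hne hf.continuous c (fun i => max (p.1 i) (b i)) p.2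
  refine continuous_of_unique_argmin hXc
    (J := fun p y => f y + c * diagNormSq (fun i => max (p.1 i) (b i)) (p.2 - y)) ?_
    (fun p => (hspec p).1) (fun p => (hspec p).2) fun p y hy hmin => ?_
  · have h1 : Continuous fun q : ((Fin d → ℝ) × EuclideanSpace ℝ (Fin d)) ×
        EuclideanSpace ℝ (Fin d) => ((fun i => max (q.1.1 i) (b i)), q.1.2 - q.2) := by
      fun_prop
    exact (hf.continuous.comp continuous_snd).add
      (continuous_const.mul (continuous_diagNormSq.comp h1))
  · refine IsProx.unique hf hX (fun i => ?_) ⟨hy, hmin⟩ (hspec p)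
    have := mul_le_mul_of_nonneg_left (le_max_right (p.1 i) (b i)) hc
    linarith [hκ i]

end Prox

/-! ### The scaled Moreau envelope -/

section Envelope

variable {d : ℕ} {X : Set (EuclideanSpace ℝ (Fin d))} {f : EuclideanSpace ℝ (Fin d) → ℝ}

lemma envelope_eq {ρ : ℝ} (hρ : 0 < ρ) {w : Fin d → ℝ} {x p : EuclideanSpace ℝ (Fin d)}
    (hp : IsProx X f ρ w x p) :
    envelope X f (1 / (2 * ρ)) w x = f p + ρ * diagNormSq w (x - p) := by
  have hζ : 1 / (2 * (1 / (2 * ρ))) = ρ := by field_simp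
  unfold envelope
  rw [hζ]
  have : Nonempty X := ⟨⟨p, hp.1⟩⟩
  refine le_antisymm (ciInf_le ⟨f p + ρ * diagNormSq w (x - p), ?_⟩ (⟨p, hp.1⟩ : X))
    (le_ciInf fun y => hp.2 y y.2)
  rintro _ ⟨y, rfl⟩
  exact hp.2 y y.2

/-- The weighted inner product `⟨diag(w) a, b⟩` and the squared norm: expansion of a square. -/
lemma diagNormSq_add (w : Fin d → ℝ) (a b : EuclideanSpace ℝ (Fin d)) :
    diagNormSq w (a + b) = diagNormSq w a +
      2 * inner ℝ (WithLp.toLp 2 fun i => w i * a i : EuclideanSpace ℝ (Fin d)) b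
        + diagNormSq w b := by
  simp only [diagNormSq, PiLp.inner_apply, Finset.mul_sum, ← Finset.sum_add_distrib]
  refine Finset.sum_congr rfl fun i _ => ?_
  simp
  ring

/-- The proximal map is Lipschitz: the weighted distance of two proximal points is at most
twice that of their centres. -/
lemma IsProx.diagNormSq_sub_le {ρ : ℝ} (hρ : 0 < ρ) {κ w : Fin d → ℝ} (hf : WeaklyConvex ρ κ f)
    (hX : Convex ℝ X) (hw : ∀ i, 0 ≤ w i) (hκ : ∀ i, κ i ≤ w i)
    {x x' p p' : EuclideanSpace ℝ (Fin d)}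
    (hp : IsProx X f ρ w x p) (hp' : IsProx X f ρ w x' p') :
    diagNormSq w (p - p') ≤ 4 * diagNormSq w (x - x') := by
  have h1 := hp.growth hf hX hp'.1
  have h2 := hp'.growth hf hX hp.1
  rw [diagNormSq_sub_comm w p' p, diagNormSq_sub_comm κ p' p] at h2
  have h3 := diagNormSq_mono hκ (p - p')
  have h4 : diagNormSq w (x - p') + diagNormSq w (x' - p) - diagNormSq w (x - p)
      - diagNormSq w (x' - p') ≤ 1 / 2 * diagNormSq w (p - p') + 2 * diagNormSq w (x - x') := by
    simp only [diagNormSq, Finset.mul_sum, ← Finset.sum_add_distrib, ← Finset.sum_sub_distrib]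
    refine Finset.sum_le_sum fun i _ => ?_
    simp only [PiLp.sub_apply]
    nlinarith [mul_nonneg (hw i) (sq_nonneg ((p i - p' i) - 2 * (x i - x' i)))]
  have h5 : ρ * diagNormSq w (p - p') ≤ ρ * (1 / 2 * diagNormSq w (p - p')
      + 2 * diagNormSq w (x - x')) := by nlinarith
  have := le_of_mul_le_mul_left h5 hρ
  linarith

/-- The envelope is differentiable, and its gradient is `2ρ W (x - p)`, where `p` is the proximal
point of `x`. -/
lemma hasGradientAt_envelope {ρ : ℝ} (hρ : 0 < ρ) {κ w : Fin d → ℝ} (hf : WeaklyConvex ρ κ f)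
    (hX : Convex ℝ X) (hXc : IsCompact X) (hne : X.Nonempty) (hw : ∀ i, 0 ≤ w i)
    (hκ : ∀ i, κ i ≤ w i) (x : EuclideanSpace ℝ (Fin d)) :
    HasGradientAt (envelope X f (1 / (2 * ρ)) w)
      (WithLp.toLp 2 fun i => 2 * ρ * (w i * (x i - prox X f ρ w x i))) x := by
  have hspec := isProx_prox hXc hne hf.continuous ρ w
  set p := prox X f ρ w with hpdef
  set G : EuclideanSpace ℝ (Fin d) := WithLp.toLp 2 fun i => 2 * ρ * (w i * (x i - p x i)) with hG
  have hGin : ∀ a b z : EuclideanSpace ℝ (Fin d), 2 * ρ *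
      inner ℝ (WithLp.toLp 2 fun i => w i * (a - b) i : EuclideanSpace ℝ (Fin d)) z =
      2 * ρ * ∑ i, w i * (a i - b i) * z i := by
    intro a b z
    simp [PiLp.inner_apply]
    left
    exact Finset.sum_congr rfl fun i _ => by ring
  obtain ⟨M, hM0, hM⟩ : ∃ M : ℝ, 0 ≤ M ∧ ∀ i, w i ≤ M :=
    ⟨∑ i, w i, Finset.sum_nonneg fun i _ => hw i, fun i =>
      Finset.single_le_sum (f := w) (fun j _ => hw j) (Finset.mem_univ i)⟩
  -- both bounds compare the minimiser at one centre with the objective at the other centre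
  have hup : ∀ a b : EuclideanSpace ℝ (Fin d), envelope X f (1 / (2 * ρ)) w b ≤
      envelope X f (1 / (2 * ρ)) w a + 2 * ρ * ∑ i, w i * (a i - p a i) * (b i - a i)
        + ρ * diagNormSq w (b - a) := by
    intro a b
    rw [envelope_eq hρ (hspec a), envelope_eq hρ (hspec b)]
    have h1 := (hspec b).2 (p a) (hspec a).1
    have h2 := diagNormSq_add w (a - p a) (b - a)
    have h3 := hGin a (p a) (b - a)
    rw [show a - p a + (b - a) = b - p a by abel] at h2
    rw [h2] at h1
    simp only [PiLp.sub_apply] at h3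
    simp only [PiLp.sub_apply] at h1
    linarith
  have hbound : ∀ x' : EuclideanSpace ℝ (Fin d),
      |envelope X f (1 / (2 * ρ)) w x' - envelope X f (1 / (2 * ρ)) w x - inner ℝ G (x' - x)| ≤
        (4 * ρ * M) * ‖x' - x‖ ^ 2 := by
    intro x'
    have e0 : inner ℝ G (x' - x) = 2 * ρ * ∑ i, w i * (x i - p x i) * (x' i - x i) := by
      rw [hG]
      simp only [PiLp.inner_apply, Finset.mul_sum]
      refine Finset.sum_congr rfl fun i _ => ?_
      simp
      ring
    have h1 := hup x x'
    have h2 := hup x' x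
    have h3 : 2 * ρ * ∑ i, w i * (x' i - p x' i) * (x i - x' i) ≤
        -(2 * ρ * ∑ i, w i * (x i - p x i) * (x' i - x i))
          + ρ * diagNormSq w (x' - x) * (-1) + ρ * diagNormSq w (p x - p x') * (1 / 2)
          + ρ * diagNormSq w (x' - x) * 1 := by
      simp only [diagNormSq, Finset.mul_sum, Finset.sum_mul, ← Finset.sum_neg_distrib,
        ← Finset.sum_add_distrib]
      refine Finset.sum_le_sum fun i _ => ?_
      simp only [PiLp.sub_apply]
      have := mul_nonneg (mul_nonneg hρ.le (hw i))
        (sq_nonneg ((p x i - p x' i) + 2 * (x' i - x i)))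
      nlinarith
    have h4 := (hspec x).diagNormSq_sub_le hρ hf hX hw hκ (hspec x')
    rw [diagNormSq_sub_comm w x x'] at h4 h2
    have h5 := diagNormSq_le_mul_norm_sq hM (x' - x)
    have h6 := diagNormSq_nonneg hw (x' - x)
    have h7 : ρ * diagNormSq w (x' - x) ≤ ρ * (M * ‖x' - x‖ ^ 2) :=
      mul_le_mul_of_nonneg_left h5 hρ.le
    have h8 : ρ * diagNormSq w (p x - p x') ≤ ρ * (4 * diagNormSq w (x' - x)) :=
      mul_le_mul_of_nonneg_left h4 hρ.le
    have h9 : 0 ≤ ρ * diagNormSq w (x' - x) := mul_nonneg hρ.le h6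
    rw [abs_le, e0]
    constructor <;> linarith
  rw [hasGradientAt_iff_isLittleO]
  have hO : (fun x' => envelope X f (1 / (2 * ρ)) w x' - envelope X f (1 / (2 * ρ)) w x
      - inner ℝ G (x' - x)) =O[𝓝 x] fun x' => ‖x' - x‖ ^ 2 := by
    refine Asymptotics.IsBigO.of_bound (4 * ρ * M) (Eventually.of_forall fun x' => ?_)
    rw [Real.norm_eq_abs, Real.norm_of_nonneg (sq_nonneg _)]
    exact hbound x'
  refine hO.trans_isLittleO ?_
  have := (Asymptotics.isLittleO_norm_pow_id (E' := EuclideanSpace ℝ (Fin d)) one_lt_two)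
  exact this.comp_tendsto (k := fun x' => x' - x) (by
    have : Tendsto (fun x' => x' - x) (𝓝 x) (𝓝 (x - x)) :=
      (continuous_id.sub continuous_const).tendsto x
    simpa using this)

/-- The squared dual norm of the gradient `2ρ W z` of the envelope. -/
lemma diagNormSq_inv_toLp {w : Fin d → ℝ} (hw : ∀ i, 0 < w i) (c : ℝ)
    (z : EuclideanSpace ℝ (Fin d)) :
    diagNormSq (fun i => (w i)⁻¹) (WithLp.toLp 2 fun i => c * (w i * z i)) =
      c ^ 2 * diagNormSq w z := by
  simp only [diagNormSq, Finset.mul_sum]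
  refine Finset.sum_congr rfl fun i _ => ?_
  have := (hw i).ne'
  field_simp

/-- Proximal points of one centre for two scalings `w ≤ w'`: the squared distances to the centre
are comparable up to the total increase of the scaling. -/
lemma IsProx.diagNormSq_le_of_le {ρ : ℝ} (hρ : 0 < ρ) {κ w w' : Fin d → ℝ}
    (hf : WeaklyConvex ρ κ f) (hX : Convex ℝ X) (hw : ∀ i, 0 ≤ w i) (hκ : ∀ i, κ i ≤ w i)
    (hww : ∀ i, w i ≤ w' i) {D : ℝ} {x p p' : EuclideanSpace ℝ (Fin d)}
    (hp : IsProx X f ρ w x p) (hp' : IsProx X f ρ w' x p') (hD : ∀ i, |(x - p) i| ≤ D) :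
    diagNormSq w' (x - p') ≤
      2 * diagNormSq w (x - p) + 5 * (D ^ 2 * (∑ i, w' i - ∑ i, w i)) := by
  have h1 := hp.growth hf hX hp'.1
  have h2 := hp'.growth hf hX hp.1
  rw [diagNormSq_sub_comm w' p' p, diagNormSq_sub_comm κ p' p] at h2
  have h3 := diagNormSq_mono hκ (p - p')
  have h4 := diagNormSq_mono hww (p - p')
  have h5 := diagNormSq_le_add hww hD
  have h6 := Zema.diagNormSq_sub_le hw x p p'
  have h7 := diagNormSq_mono hww (x - p')
  have h8 := diagNormSq_nonneg hw (p - p')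
  set E := D ^ 2 * (∑ i, w' i - ∑ i, w i)
  -- the sum of the two growth inequalities, divided by `ρ`
  have h9 : diagNormSq w' (x - p') - diagNormSq w (x - p') + diagNormSq w (p - p') ≤
      diagNormSq w' (x - p) - diagNormSq w (x - p) := by
    have : ρ * (diagNormSq w' (x - p') - diagNormSq w (x - p') + diagNormSq w (p - p')) ≤
      ρ * (diagNormSq w' (x - p) - diagNormSq w (x - p)) := by nlinarith
    exact le_of_mul_le_mul_left this hρ
  linarith

end Envelope

/-! ### Smoothing over the unit ball -/

section Smoothing

variable {d : ℕ}

instance isProbabilityMeasure_ballUniform : IsProbabilityMeasure (ballUniform d) := by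
  refine cond_isProbabilityMeasure_of_finite ?_ measure_closedBall_lt_top.ne
  exact (Metric.measure_closedBall_pos volume _ one_pos).ne'

lemma integral_ballUniform (g : EuclideanSpace ℝ (Fin d) → ℝ) :
    ∫ u, g u ∂(ballUniform d) =
      (volume.real (Metric.closedBall (0 : EuclideanSpace ℝ (Fin d)) 1))⁻¹ *
        ∫ u in Metric.closedBall 0 1, g u := by
  unfold ballUniform ProbabilityTheory.cond
  rw [integral_smul_measure, ENNReal.toReal_inv, smul_eq_mul]
  rfl

lemma ae_norm_le_one_ballUniform : ∀ᵐ u ∂(ballUniform d), ‖u‖ ≤ 1 := by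
  unfold ballUniform
  filter_upwards [ae_cond_mem (μ := (volume : Measure (EuclideanSpace ℝ (Fin d))))
    (Metric.isClosed_closedBall (x := 0) (ε := 1)).measurableSet] with u hu
  simpa using hu

lemma integrable_ballUniform {g : EuclideanSpace ℝ (Fin d) → ℝ} (hg : Continuous g) :
    Integrable g (ballUniform d) := by
  unfold ballUniform ProbabilityTheory.cond
  refine Integrable.smul_measure ?_
    (ENNReal.inv_ne_top.2 (Metric.measure_closedBall_pos volume _ one_pos).ne')
  exact hg.continuousOn.integrableOn_compact (isCompact_closedBall _ _)

/-- Odd functions integrate to zero over the ball. -/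
lemma integral_ballUniform_of_odd {g : EuclideanSpace ℝ (Fin d) → ℝ} (hg : ∀ u, g (-u) = -g u) :
    ∫ u, g u ∂(ballUniform d) = 0 := by
  have hB : MeasurableSet (Metric.closedBall (0 : EuclideanSpace ℝ (Fin d)) 1) :=
    Metric.isClosed_closedBall.measurableSet
  have h1 : ∫ u in Metric.closedBall (0 : EuclideanSpace ℝ (Fin d)) 1, g u =
      -∫ u in Metric.closedBall (0 : EuclideanSpace ℝ (Fin d)) 1, g u := by
    conv_lhs => rw [← integral_indicator hB, ← integral_neg_eq_self]
    rw [← integral_indicator hB, ← integral_neg]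
    refine integral_congr_ae (Eventually.of_forall fun u => ?_)
    by_cases hu : u ∈ Metric.closedBall (0 : EuclideanSpace ℝ (Fin d)) 1
    · have hu' : -u ∈ Metric.closedBall (0 : EuclideanSpace ℝ (Fin d)) 1 := by simpa using hu
      simp only [Set.indicator_of_mem hu, Set.indicator_of_mem hu', hg]
    · have hu' : -u ∉ Metric.closedBall (0 : EuclideanSpace ℝ (Fin d)) 1 := by simpa using hu
      simp only [Set.indicator_of_notMem hu, Set.indicator_of_notMem hu', neg_zero]
  rw [integral_ballUniform, show ∫ u in Metric.closedBall (0 : EuclideanSpace ℝ (Fin d)) 1, g u = 0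
    by linarith, mul_zero]

/-- The smoothing kernel `(1 - ‖u‖²)⁺ / 2`. On the unit ball its gradient is `-u`, which is why the
direction `u`, uniform on the ball, produces gradients of the smoothing by this kernel. -/
def kernel (u : EuclideanSpace ℝ (Fin d)) : ℝ := max (1 - ‖u‖ ^ 2) 0 / 2

lemma kernel_of_le {u : EuclideanSpace ℝ (Fin d)} (hu : ‖u‖ ≤ 1) :
    kernel u = (1 - ‖u‖ ^ 2) / 2 := by
  rw [kernel, max_eq_left]
  nlinarith [norm_nonneg u]

lemma kernel_of_ge {u : EuclideanSpace ℝ (Fin d)} (hu : 1 ≤ ‖u‖) : kernel u = 0 := by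
  rw [kernel, max_eq_right, zero_div]
  nlinarith

lemma kernel_nonneg (u : EuclideanSpace ℝ (Fin d)) : 0 ≤ kernel u := by
  unfold kernel
  positivity

lemma kernel_le_half (u : EuclideanSpace ℝ (Fin d)) : kernel u ≤ 1 / 2 := by
  unfold kernel
  have : max (1 - ‖u‖ ^ 2) 0 ≤ 1 := max_le (by nlinarith [sq_nonneg ‖u‖]) zero_le_one
  linarith

lemma continuous_kernel : Continuous (kernel (d := d)) := by
  unfold kernel
  fun_prop

lemma kernel_neg (u : EuclideanSpace ℝ (Fin d)) : kernel (-u) = kernel u := by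
  simp [kernel]

lemma hasCompactSupport_kernel : HasCompactSupport (kernel (d := d)) :=
  HasCompactSupport.intro (isCompact_closedBall 0 1) fun u hu => kernel_of_ge (by
    simp only [Metric.mem_closedBall, dist_zero_right, not_le] at hu
    exact hu.le)

lemma abs_kernel_sub_le (u v : EuclideanSpace ℝ (Fin d)) :
    |kernel u - kernel v| ≤ ‖u - v‖ := by
  have aux : ∀ a b : EuclideanSpace ℝ (Fin d), kernel a - kernel b ≤ ‖a - b‖ := by
    intro a b
    have h0 := norm_sub_norm_le b a
    rw [norm_sub_rev] at h0
    have ha := norm_nonneg a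
    have hab := norm_nonneg (a - b)
    have hb0 := kernel_nonneg b
    rcases le_total 1 ‖a‖ with h1 | h1
    · rw [kernel_of_ge h1]; linarith
    · rcases le_total ‖b‖ 1 with h2 | h2
      · rw [kernel_of_le h1, kernel_of_le h2]
        rcases le_total ‖b‖ ‖a‖ with h3 | h3 <;> nlinarith [norm_nonneg b]
      · rw [kernel_of_le h1, kernel_of_ge h2]
        nlinarith
  exact abs_sub_le_iff.2 ⟨aux u v, by rw [norm_sub_rev]; exact aux v u⟩

/-- The difference quotients of the kernel along `δ` tend to `⟨u, δ⟩` inside the ball and to `0`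
outside. -/
lemma tendsto_kernel_quotient (δ u : EuclideanSpace ℝ (Fin d)) (hu : ‖u‖ ≠ 1) :
    Tendsto (fun s : ℝ => s⁻¹ * (kernel (u - s • δ) - kernel u)) (𝓝[>] 0)
      (𝓝 ((Metric.closedBall 0 1).indicator (fun v => inner ℝ v δ) u)) := by
  have hnorm : Tendsto (fun s : ℝ => ‖u - s • δ‖) (𝓝[>] 0) (𝓝 ‖u‖) := by
    have hc : Continuous fun s : ℝ => ‖u - s • δ‖ := by fun_prop
    simpa using (hc.tendsto 0).mono_left nhdsWithin_le_nhds
  rcases lt_or_gt_of_ne hu with h | h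
  · rw [Set.indicator_of_mem (by simpa using h.le)]
    have hlim : Tendsto (fun s : ℝ => inner ℝ u δ - s * ‖δ‖ ^ 2 / 2) (𝓝[>] 0)
        (𝓝 (inner ℝ u δ)) := by
      have hc : Continuous fun s : ℝ => inner ℝ u δ - s * ‖δ‖ ^ 2 / 2 := by fun_prop
      simpa using (hc.tendsto 0).mono_left (nhdsWithin_le_nhds (s := Set.Ioi 0))
    refine hlim.congr' ?_
    filter_upwards [hnorm.eventually (gt_mem_nhds h), self_mem_nhdsWithin] with s hs hs0
    have hs0' : s ≠ 0 := (Set.mem_Ioi.1 hs0).ne'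
    rw [kernel_of_le h.le, kernel_of_le hs.le, norm_sub_sq_real, inner_smul_right, norm_smul,
      mul_pow, Real.norm_eq_abs, sq_abs]
    field_simp
    ring
  · rw [Set.indicator_of_notMem (by simpa using h)]
    refine tendsto_const_nhds.congr' ?_
    filter_upwards [hnorm.eventually (lt_mem_nhds h)] with s hs
    rw [kernel_of_ge h.le, kernel_of_ge hs.le, sub_zero, mul_zero]

/-- The gradient inequality for the kernel smoothing of a convex function `h`, with its gradient
written as the average of `h u • u` over the ball. -/
lemma integral_mul_inner_le {h : EuclideanSpace ℝ (Fin d) → ℝ} (hh : ConvexOn ℝ Set.univ h)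
    (δ : EuclideanSpace ℝ (Fin d)) :
    ∫ u, h u * inner ℝ u δ ∂(ballUniform d) ≤
      ∫ u, kernel u * (h (u + δ) - h u) ∂(ballUniform d) := by
  have hc : Continuous h := (ConvexOn.locallyLipschitz hh).continuous
  have hB : MeasurableSet (Metric.closedBall (0 : EuclideanSpace ℝ (Fin d)) 1) :=
    Metric.isClosed_closedBall.measurableSet
  have hint : ∀ g : EuclideanSpace ℝ (Fin d) → ℝ, Continuous g →
      Integrable (fun u => kernel u * g u) := fun g hg =>
    (continuous_kernel.mul hg).integrable_of_hasCompactSupport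
      (hasCompactSupport_kernel.mul_right)
  rw [integral_ballUniform, integral_ballUniform]
  refine mul_le_mul_of_nonneg_left ?_ (inv_nonneg.2 measureReal_nonneg)
  have hR : ∫ u in Metric.closedBall 0 1, kernel u * (h (u + δ) - h u) =
      ∫ u, kernel u * (h (u + δ) - h u) := by
    refine setIntegral_eq_integral_of_forall_compl_eq_zero fun u hu => ?_
    rw [kernel_of_ge, zero_mul]
    simp only [Metric.mem_closedBall, dist_zero_right, not_le] at hu
    exact hu.le
  rw [hR, ← integral_indicator hB]
  -- the difference quotients of the smoothing, with the shift moved onto the kernel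
  have hlim : Tendsto (fun s : ℝ => ∫ u, s⁻¹ * (kernel (u - s • δ) - kernel u) * h u) (𝓝[>] 0)
      (𝓝 (∫ u, (Metric.closedBall 0 1).indicator (fun v => h v * inner ℝ v δ) u)) := by
    refine tendsto_integral_filter_of_dominated_convergence
      ((Metric.closedBall 0 (1 + ‖δ‖)).indicator fun u => ‖δ‖ * |h u|) ?_ ?_ ?_ ?_
    · refine Eventually.of_forall fun s => Continuous.aestronglyMeasurable ?_
      have := continuous_kernel (d := d)
      fun_prop
    · filter_upwards [Ioc_mem_nhdsGT (zero_lt_one' ℝ)] with s hs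
      refine Eventually.of_forall fun u => ?_
      by_cases hu : u ∈ Metric.closedBall (0 : EuclideanSpace ℝ (Fin d)) (1 + ‖δ‖)
      · rw [Set.indicator_of_mem hu, norm_mul, norm_mul, Real.norm_eq_abs, Real.norm_eq_abs,
          Real.norm_eq_abs, abs_of_pos (inv_pos.2 hs.1)]
        refine mul_le_mul_of_nonneg_right ?_ (abs_nonneg _)
        have h1 := abs_kernel_sub_le (u - s • δ) u
        rw [sub_sub_cancel_left, norm_neg, norm_smul, Real.norm_of_nonneg hs.1.le] at h1
        rw [inv_mul_le_iff₀ hs.1]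
        exact h1
      · rw [Set.indicator_of_notMem hu]
        simp only [Metric.mem_closedBall, dist_zero_right, not_le] at hu
        have h1 := norm_nonneg δ
        have h2 : ‖s • δ‖ ≤ ‖δ‖ := by
          rw [norm_smul, Real.norm_of_nonneg hs.1.le]
          exact mul_le_of_le_one_left h1 hs.2
        have h3 := norm_sub_norm_le u (s • δ)
        rw [kernel_of_ge (by linarith : 1 ≤ ‖u - s • δ‖), kernel_of_ge (by linarith : 1 ≤ ‖u‖)]
        simp
    · rw [integrable_indicator_iff Metric.isClosed_closedBall.measurableSet]
      refine ContinuousOn.integrableOn_compact (isCompact_closedBall _ _) ?_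
      exact (continuous_const.mul hc.abs).continuousOn
    · have hs : ∀ᵐ u : EuclideanSpace ℝ (Fin d), u ∉ Metric.sphere 0 1 :=
        measure_eq_zero_iff_ae_notMem.1 (Measure.addHaar_sphere_of_ne_zero volume 0 one_ne_zero)
      filter_upwards [hs] with u hu
      have h1 := (tendsto_kernel_quotient δ u (by simpa using hu)).mul_const (h u)
      convert h1 using 2
      by_cases hu : u ∈ Metric.closedBall (0 : EuclideanSpace ℝ (Fin d)) 1
      · simp only [Set.indicator_of_mem hu]
        ring
      · simp only [Set.indicator_of_notMem hu, zero_mul]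
  refine le_of_tendsto hlim ?_
  filter_upwards [Ioc_mem_nhdsGT (zero_lt_one' ℝ)] with s hs
  have hshift : ∫ u, kernel u * h (u + s • δ) = ∫ u, kernel (u - s • δ) * h u := by
    rw [← integral_add_right_eq_self (fun u => kernel (u - s • δ) * h u) (s • δ)]
    simp only [add_sub_cancel_right]
  have hint2 : Integrable fun u => kernel (u - s • δ) * h u := by
    have := (hint (fun u => h (u + s • δ)) (by fun_prop)).comp_sub_right (s • δ)
    simpa using this
  have e1 : ∫ u, s⁻¹ * (kernel (u - s • δ) - kernel u) * h u =
      s⁻¹ * ∫ u, kernel u * (h (u + s • δ) - h u) := by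
    have e2 : ∫ u, kernel u * (h (u + s • δ) - h u) =
        ∫ u, (kernel (u - s • δ) * h u - kernel u * h u) := by
      simp only [mul_sub]
      rw [integral_sub (hint (fun u => h (u + s • δ)) (by fun_prop)) (hint h hc), hshift,
        integral_sub hint2 (hint h hc)]
    rw [e2, ← integral_const_mul]
    exact integral_congr_ae (Eventually.of_forall fun u => by simp only []; ring)
  rw [e1, inv_mul_le_iff₀ hs.1, ← integral_const_mul]
  refine integral_mono (hint (fun u => h (u + s • δ) - h u) (by fun_prop))
    ((hint (fun u => h (u + δ) - h u) (by fun_prop)).const_mul s) fun u => ?_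
  have h1 := hh.2 (Set.mem_univ u) (Set.mem_univ (u + δ)) (sub_nonneg.2 hs.2) hs.1.le (by ring)
  have h2 : (1 - s) • u + s • (u + δ) = u + s • δ := by module
  rw [h2] at h1
  simp only [smul_eq_mul] at h1 ⊢
  have h3 := mul_le_mul_of_nonneg_left h1 (kernel_nonneg u)
  linarith

lemma ballUniform_real_closedBall {r : ℝ} (hr0 : 0 ≤ r) (hr : r ≤ 1) :
    (ballUniform d).real (Metric.closedBall 0 r) = r ^ d := by
  have hsub : Metric.closedBall (0 : EuclideanSpace ℝ (Fin d)) r ⊆ Metric.closedBall 0 1 :=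
    Metric.closedBall_subset_closedBall hr
  have hpos := Metric.measure_ball_pos volume (0 : EuclideanSpace ℝ (Fin d)) one_pos
  have hfin := (measure_ball_lt_top (μ := volume) (x := (0 : EuclideanSpace ℝ (Fin d))) (r := 1)).ne
  unfold ballUniform
  rw [measureReal_def, cond_apply Metric.isClosed_closedBall.measurableSet,
    Set.inter_eq_right.2 hsub, Measure.addHaar_closedBall _ _ hr0,
    Measure.addHaar_closedBall _ _ zero_le_one]
  simp only [one_pow, ENNReal.ofReal_one, one_mul, finrank_euclideanSpace, Fintype.card_fin]
  rw [mul_comm, mul_assoc, ENNReal.mul_inv_cancel hpos.ne' hfin, mul_one,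
    ENNReal.toReal_ofReal (by positivity)]

/-- The mass of the kernel is at least of order `1 / d`: already the ball of radius `1 - 1/(2d)`
contributes that much. -/
lemma le_integral_kernel (hd : 1 ≤ d) : 1 / 8 ≤ d * ∫ u, kernel u ∂(ballUniform d) := by
  have hd' : (1 : ℝ) ≤ d := by exact_mod_cast hd
  have hd0 : (0 : ℝ) < d := by linarith
  set r : ℝ := 1 - 1 / (2 * d) with hr
  have hinv : 1 / (2 * d : ℝ) ≤ 1 / 2 := by
    rw [div_le_div_iff₀ (by positivity) (by positivity)]; linarith
  have hinv0 : 0 < 1 / (2 * d : ℝ) := by positivity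
  have hr0 : 1 / 2 ≤ r := by rw [hr]; linarith
  have hr1 : r ≤ 1 := by rw [hr]; linarith
  have hpow : 1 / 2 ≤ r ^ d := by
    have := one_add_mul_le_pow (a := -(1 / (2 * d : ℝ))) (by linarith) d
    rw [show (1 : ℝ) + -(1 / (2 * d)) = r by rw [hr]; ring] at this
    refine le_trans (le_of_eq ?_) this
    field_simp
    norm_num
  have h1 : (1 - r ^ 2) / 2 * r ^ d ≤ ∫ u, kernel u ∂(ballUniform d) := by
    rw [← ballUniform_real_closedBall (d := d) (by linarith) hr1, mul_comm, ← smul_eq_mul,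
      ← integral_indicator_const _ Metric.isClosed_closedBall.measurableSet]
    refine integral_mono ?_ (integrable_ballUniform continuous_kernel) fun u => ?_
    · exact (integrable_const _).indicator Metric.isClosed_closedBall.measurableSet
    · by_cases hu : u ∈ Metric.closedBall (0 : EuclideanSpace ℝ (Fin d)) r
      · rw [Set.indicator_of_mem hu]
        have hu' : ‖u‖ ≤ r := by simpa using hu
        rw [kernel_of_le (hu'.trans hr1)]
        nlinarith [norm_nonneg u]
      · rw [Set.indicator_of_notMem hu]
        exact kernel_nonneg u
  have h2 : 1 / (2 * d : ℝ) ≤ 1 - r ^ 2 := by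
    have : 1 / (2 * d : ℝ) = 1 - r := by rw [hr]; ring
    nlinarith
  have h3 : 1 / (2 * d : ℝ) / 2 * (1 / 2) ≤ ∫ u, kernel u ∂(ballUniform d) := by
    refine le_trans ?_ h1
    have : 0 ≤ (1 - r ^ 2) / 2 := by linarith
    nlinarith
  calc (1 : ℝ) / 8 = d * (1 / (2 * d : ℝ) / 2 * (1 / 2)) := by field_simp; norm_num
    _ ≤ _ := mul_le_mul_of_nonneg_left h3 hd0.le

lemma integral_kernel_le : ∫ u, kernel u ∂(ballUniform d) ≤ 1 / 2 := by
  have := integral_mono (integrable_ballUniform continuous_kernel) (integrable_const (1 / 2 : ℝ))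
    (fun u => kernel_le_half (d := d) u)
  simpa using this

/-- The averaged two-point difference of a weakly convex function satisfies the gradient inequality
of the function itself, up to the smoothing error `2Lμ` and the weak convexity term. -/
lemma integral_two_point_le {ρ : ℝ} {κ : Fin d → ℝ} {f : EuclideanSpace ℝ (Fin d) → ℝ}
    (hf : WeaklyConvex ρ κ f) {μ L : ℝ} (hμ : 0 < μ) {X : Set (EuclideanSpace ℝ (Fin d))}
    (hL : ∀ x ∈ Metric.cthickening μ X, ∀ y ∈ Metric.cthickening μ X, |f x - f y| ≤ L * ‖x - y‖)
    (hL0 : 0 ≤ L) {x y : EuclideanSpace ℝ (Fin d)} (hx : x ∈ X) (hy : y ∈ X) :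
    ∫ u, (f (x + μ • u) - f x) * inner ℝ u (y - x) ∂(ballUniform d) ≤
      μ * ((∫ u, kernel u ∂(ballUniform d)) *
        (f y - f x + ρ / 2 * diagNormSq κ (y - x) + 2 * L * μ)) := by
  have hfc := hf.continuous
  set δ : EuclideanSpace ℝ (Fin d) := μ⁻¹ • (y - x) with hδ
  have hyx : y - x = μ • δ := by rw [hδ, smul_inv_smul₀ hμ.ne']
  -- the convex function `u ↦ f (x + μ u) + (ρ/2) ‖μ u‖²`
  set h : EuclideanSpace ℝ (Fin d) → ℝ :=
    fun u => f (x + μ • u) + ρ / 2 * diagNormSq κ (μ • u) with hh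
  have hconv : ConvexOn ℝ Set.univ h := by
    have h1 := (hf.convexOn_add x).comp_affineMap
      ((μ • LinearMap.id : EuclideanSpace ℝ (Fin d) →ₗ[ℝ] _).toAffineMap
        + AffineMap.const ℝ (EuclideanSpace ℝ (Fin d)) x)
    rw [Set.preimage_univ] at h1
    convert! h1 using 1
    funext u
    simp [hh, add_comm x]
    left
    simp [diagNormSq]
  have hdc : Continuous fun u : EuclideanSpace ℝ (Fin d) => diagNormSq κ (μ • u) :=
    continuous_diagNormSq.comp (continuous_const.prodMk (continuous_const_smul μ))
  have hneg : ∀ z : EuclideanSpace ℝ (Fin d), diagNormSq κ (-z) = diagNormSq κ z := fun z => by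
    simp [diagNormSq]
  have key := integral_mul_inner_le hconv δ
  have hL1 : ∫ u, h u * inner ℝ u δ ∂(ballUniform d) =
      ∫ u, (f (x + μ • u) - f x) * inner ℝ u δ ∂(ballUniform d) := by
    have hodd := integral_ballUniform_of_odd (d := d)
      (g := fun u => (f x + ρ / 2 * diagNormSq κ (μ • u)) * inner ℝ u δ) (fun u => by
        simp only [smul_neg, hneg, inner_neg_left]; ring)
    have : ∀ u, h u * inner ℝ u δ = (f (x + μ • u) - f x) * inner ℝ u δ +
        (f x + ρ / 2 * diagNormSq κ (μ • u)) * inner ℝ u δ := fun u => by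
      simp only [hh]; ring
    simp only [this]
    rw [integral_add (integrable_ballUniform (by fun_prop)) (integrable_ballUniform (by fun_prop)),
      hodd, add_zero]
  have hR1 : ∫ u, kernel u * (h (u + δ) - h u) ∂(ballUniform d) ≤
      ∫ u, (kernel u * (f y - f x + ρ / 2 * diagNormSq κ (y - x) + 2 * L * μ) +
        kernel u * (ρ * inner ℝ (WithLp.toLp 2 fun i => κ i * (μ • u) i :
          EuclideanSpace ℝ (Fin d)) (y - x))) ∂(ballUniform d) := by
    have hk := continuous_kernel (d := d)
    refine integral_mono_ae (integrable_ballUniform ?_) (integrable_ballUniform ?_) ?_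
    · simp only [hh]
      have : Continuous fun u : EuclideanSpace ℝ (Fin d) => diagNormSq κ (μ • (u + δ)) :=
        hdc.comp (continuous_id.add continuous_const)
      fun_prop
    · simp only [PiLp.inner_apply]
      fun_prop
    · filter_upwards [ae_norm_le_one_ballUniform] with u hu
      rw [← mul_add]
      refine mul_le_mul_of_nonneg_left ?_ (kernel_nonneg u)
      have hmem : ∀ z ∈ X, z + μ • u ∈ Metric.cthickening μ X := fun z hz => by
        refine Metric.mem_cthickening_of_dist_le _ z μ X hz ?_
        rw [dist_eq_norm, add_sub_cancel_left, norm_smul, Real.norm_of_nonneg hμ.le]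
        exact mul_le_of_le_one_right hμ.le hu
      have hself : ∀ z ∈ X, z ∈ Metric.cthickening μ X := fun z hz =>
        Metric.self_subset_cthickening X hz
      have hclose : ∀ z ∈ X, |f (z + μ • u) - f z| ≤ L * μ := fun z hz => by
        refine (hL _ (hmem z hz) _ (hself z hz)).trans (mul_le_mul_of_nonneg_left ?_ hL0)
        rw [add_sub_cancel_left, norm_smul, Real.norm_of_nonneg hμ.le]
        exact mul_le_of_le_one_right hμ.le hu
      have h1 := (abs_le.1 (hclose x hx)).1
      have h2 := (abs_le.1 (hclose y hy)).2
      have h3 := diagNormSq_add κ (μ • u) (y - x)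
      have h4 : x + μ • (u + δ) = y + μ • u := by
        rw [smul_add, ← hyx]; abel
      have h5 : μ • (u + δ) = μ • u + (y - x) := by rw [smul_add, ← hyx]
      simp only [hh]
      rw [h4, h5, h3]
      linarith
  have hR2 : ∫ u, kernel u * (ρ * inner ℝ (WithLp.toLp 2 fun i => κ i * (μ • u) i :
          EuclideanSpace ℝ (Fin d)) (y - x)) ∂(ballUniform d) = 0 := by
    refine integral_ballUniform_of_odd fun u => ?_
    rw [kernel_neg]
    simp [PiLp.inner_apply]
  have hk := continuous_kernel (d := d)
  rw [integral_add (integrable_ballUniform (by fun_prop)) (integrable_ballUniform (by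
    simp only [PiLp.inner_apply]; fun_prop)), hR2, add_zero, integral_mul_const] at hR1
  have hfin : ∫ u, (f (x + μ • u) - f x) * inner ℝ u (y - x) ∂(ballUniform d) =
      μ * ∫ u, (f (x + μ • u) - f x) * inner ℝ u δ ∂(ballUniform d) := by
    rw [← integral_const_mul]
    refine integral_congr_ae (Eventually.of_forall fun u => ?_)
    simp only [hyx, inner_smul_right]
    ring
  rw [hfin, ← hL1]
  exact mul_le_mul_of_nonneg_left (key.trans hR1) hμ.le

end Smoothing

/-! ### Trajectories for given gradient estimates -/

section Trajectory

variable {d : ℕ} {X : Set (EuclideanSpace ℝ (Fin d))}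

/-- `s` is the sequence of states of the method when the gradient estimates are the vectors `g t`,
wherever these come from; the step size is constant. -/
structure Trajectory (X : Set (EuclideanSpace ℝ (Fin d))) (A : ℝ) (b : ℕ → ℝ) (β₂ β₃ : ℝ)
    (x₀ : EuclideanSpace ℝ (Fin d)) (q : Fin d → ℝ) (s : ℕ → State d)
    (g : ℕ → EuclideanSpace ℝ (Fin d)) : Prop where
  x_zero : (s 0).x = x₀
  m_zero : (s 0).m = 0
  v_zero : (s 0).v = 0
  vhat_zero : (s 0).vhat = q
  m_succ : ∀ t, (s (t + 1)).m = nextM (b t) (s t).m (g t)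
  v_succ : ∀ t, (s (t + 1)).v = nextV β₂ (s t).v (g t)
  vhat_succ : ∀ t, (s (t + 1)).vhat = nextVhat β₃ (s t).vhat (s (t + 1)).v
  x_succ : ∀ t, (s (t + 1)).x = nextX X A (s (t + 1)).vhat (s t).x (s (t + 1)).m

/-- The diagonal of `V̂^{1/2}` in a state. At the start of iteration `t` it is that of
`V̂_{t-1}^{1/2}`. -/
def State.weights (s : State d) : Fin d → ℝ := fun i => √(s.vhat i)

namespace Trajectory

variable {A β₁ β₂ β₃ : ℝ} {b : ℕ → ℝ} {x₀ : EuclideanSpace ℝ (Fin d)} {q : Fin d → ℝ}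
  {s : ℕ → State d} {g : ℕ → EuclideanSpace ℝ (Fin d)}

lemma vhat_le_succ (h : Trajectory X A b β₂ β₃ x₀ q s g) (hβ₃ : β₃ ≤ 1) (t : ℕ) (i : Fin d) :
    (s t).vhat i ≤ (s (t + 1)).vhat i := by
  rw [h.vhat_succ, nextVhat]
  nlinarith [le_max_left ((s t).vhat i) ((s (t + 1)).v i)]

lemma le_vhat (h : Trajectory X A b β₂ β₃ x₀ q s g) (hβ₃ : β₃ ≤ 1) (t : ℕ) (i : Fin d) :
    q i ≤ (s t).vhat i := by
  induction t with
  | zero => rw [h.vhat_zero]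
  | succ t ih => exact ih.trans (h.vhat_le_succ hβ₃ t i)

lemma weights_le_succ (h : Trajectory X A b β₂ β₃ x₀ q s g) (hβ₃ : β₃ ≤ 1) (t : ℕ) (i : Fin d) :
    (s t).weights i ≤ (s (t + 1)).weights i :=
  Real.sqrt_le_sqrt (h.vhat_le_succ hβ₃ t i)

lemma le_weights (h : Trajectory X A b β₂ β₃ x₀ q s g) (hβ₃ : β₃ ≤ 1) (t : ℕ) (i : Fin d) :
    √(q i) ≤ (s t).weights i :=
  Real.sqrt_le_sqrt (h.le_vhat hβ₃ t i)

lemma weights_pos (h : Trajectory X A b β₂ β₃ x₀ q s g) (hβ₃ : β₃ ≤ 1) (hq : ∀ i, 0 < q i)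
    (t : ℕ) (i : Fin d) : 0 < (s t).weights i :=
  Real.sqrt_pos.2 ((hq i).trans_le (h.le_vhat hβ₃ t i))

lemma x_mem (h : Trajectory X A b β₂ β₃ x₀ q s g) (hXc : IsCompact X) (hx₀ : x₀ ∈ X) (t : ℕ) :
    (s t).x ∈ X := by
  cases t with
  | zero => rw [h.x_zero]; exact hx₀
  | succ t =>
    rw [h.x_succ, nextX, proj_eq_prox]
    exact (isProx_prox hXc ⟨x₀, hx₀⟩ continuous_const _ _ _).1

lemma v_nonneg (h : Trajectory X A b β₂ β₃ x₀ q s g) (hβ₂ : 0 ≤ β₂) (hβ₂' : β₂ ≤ 1)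
    (t : ℕ) (i : Fin d) : 0 ≤ (s t).v i := by
  induction t with
  | zero => simp [h.v_zero]
  | succ t ih =>
    rw [h.v_succ, nextV]
    have : 0 ≤ 1 - β₂ := by linarith
    positivity

variable {G : ℝ}

lemma norm_m_le (h : Trajectory X A b β₂ β₃ x₀ q s g) (hb0 : ∀ t, 0 ≤ b t) (hb1 : ∀ t, b t ≤ 1)
    (hG : ∀ t, ‖g t‖ ≤ G) (t : ℕ) : ‖(s t).m‖ ≤ G := by
  induction t with
  | zero => rw [h.m_zero, norm_zero]; exact (norm_nonneg _).trans (hG 0)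
  | succ t ih =>
    rw [h.m_succ, nextM]
    refine (norm_add_le _ _).trans ?_
    have h1 : 0 ≤ 1 - b t := by linarith [hb1 t]
    rw [norm_smul, norm_smul, Real.norm_of_nonneg (hb0 t), Real.norm_of_nonneg h1]
    nlinarith [hb0 t, hG t]

lemma v_le (h : Trajectory X A b β₂ β₃ x₀ q s g) (hβ₂ : 0 ≤ β₂) (hβ₂' : β₂ ≤ 1)
    (hG : ∀ t, ‖g t‖ ≤ G) (t : ℕ) (i : Fin d) : (s t).v i ≤ G ^ 2 := by
  induction t with
  | zero => simp [h.v_zero]; positivity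
  | succ t ih =>
    rw [h.v_succ, nextV]
    have h1 : |g t i| ≤ G := (PiLp.norm_apply_le (g t) i).trans (hG t)
    have h2 : (g t i) ^ 2 ≤ G ^ 2 := sq_le_sq' (by linarith [neg_abs_le (g t i)])
      ((le_abs_self _).trans h1)
    nlinarith

lemma vhat_le (h : Trajectory X A b β₂ β₃ x₀ q s g) (hβ₂ : 0 ≤ β₂) (hβ₂' : β₂ ≤ 1)
    (hβ₃ : 0 ≤ β₃) (hβ₃' : β₃ ≤ 1) {qmax : ℝ} (hq : ∀ i, q i ≤ qmax)
    (hG : ∀ t, ‖g t‖ ≤ G) (t : ℕ) (i : Fin d) : (s t).vhat i ≤ max qmax (G ^ 2) := by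
  induction t with
  | zero => rw [h.vhat_zero]; exact (hq i).trans (le_max_left _ _)
  | succ t ih =>
    rw [h.vhat_succ, nextVhat]
    have h1 : max ((s t).vhat i) ((s (t + 1)).v i) ≤ max qmax (G ^ 2) :=
      max_le ih ((h.v_le hβ₂ hβ₂' hG (t + 1) i).trans (le_max_right _ _))
    nlinarith

lemma weights_le (h : Trajectory X A b β₂ β₃ x₀ q s g) (hβ₂ : 0 ≤ β₂) (hβ₂' : β₂ ≤ 1)
    (hβ₃ : 0 ≤ β₃) (hβ₃' : β₃ ≤ 1) {qmax : ℝ} (hq : ∀ i, q i ≤ qmax)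
    (hG : ∀ t, ‖g t‖ ≤ G) (t : ℕ) (i : Fin d) : (s t).weights i ≤ max (√qmax) G := by
  refine (Real.sqrt_le_sqrt (h.vhat_le hβ₂ hβ₂' hβ₃ hβ₃' hq hG t i)).trans ?_
  have hG0 : 0 ≤ G := (norm_nonneg _).trans (hG 0)
  rw [Real.sqrt_le_left (le_max_of_le_right hG0)]
  refine max_le ?_ (pow_le_pow_left₀ hG0 (le_max_right _ _) 2)
  rcases le_total 0 qmax with h0 | h0
  · calc qmax = √qmax ^ 2 := (Real.sq_sqrt h0).symm
      _ ≤ _ := pow_le_pow_left₀ (Real.sqrt_nonneg _) (le_max_left _ _) 2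
  · exact h0.trans (sq_nonneg _)

/-- The momentum is controlled, coordinate by coordinate, by the second moment estimate: this is
where `β₁ / √β₂ < 1` is needed. -/
lemma abs_m_le (h : Trajectory X A b β₂ β₃ x₀ q s g) (hb0 : ∀ t, 0 ≤ b t) (hb1 : ∀ t, b t ≤ 1)
    (hbβ : ∀ t, 1 ≤ t → b t ≤ β₁) (hβ₁ : 0 ≤ β₁) (hβ₂ : 0 < β₂) (hβ₂' : β₂ < 1)
    (hτ : β₁ / √β₂ < 1) (t : ℕ) (i : Fin d) :
    |(s t).m i| ≤ 1 / ((1 - β₁ / √β₂) * √(1 - β₂)) * √((s t).v i) := by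
  set τ := β₁ / √β₂ with hτdef
  set K := 1 / ((1 - τ) * √(1 - β₂)) with hK
  have hs2 : 0 < √β₂ := Real.sqrt_pos.2 hβ₂
  have hs1 : 0 < √(1 - β₂) := Real.sqrt_pos.2 (by linarith)
  have hτ0 : 0 ≤ τ := by positivity
  have h1τ : 0 < 1 - τ := by linarith
  have hK0 : 0 < K := by positivity
  induction t with
  | zero => simp [h.m_zero, h.v_zero]
  | succ t ih =>
    have hv0 := h.v_nonneg hβ₂.le hβ₂'.le t i
    set r := √((s (t + 1)).v i) with hr
    have hr0 : 0 ≤ r := Real.sqrt_nonneg _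
    have hv : (s (t + 1)).v i = β₂ * (s t).v i + (1 - β₂) * (g t i) ^ 2 := by
      rw [h.v_succ, nextV]
    have e1 : √β₂ * √((s t).v i) ≤ r := by
      rw [← Real.sqrt_mul hβ₂.le, hr, hv]
      exact Real.sqrt_le_sqrt (by nlinarith [sq_nonneg (g t i)])
    have e2 : √(1 - β₂) * |g t i| ≤ r := by
      rw [← Real.sqrt_sq_eq_abs, ← Real.sqrt_mul (by linarith), hr, hv]
      exact Real.sqrt_le_sqrt (by nlinarith)
    have e3 : |(s (t + 1)).m i| ≤ β₁ * |(s t).m i| + |g t i| := by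
      have hm : (s (t + 1)).m i = b t * (s t).m i + (1 - b t) * g t i := by
        rw [h.m_succ, nextM]; simp
      rw [hm]
      refine (abs_add_le _ _).trans ?_
      rw [abs_mul, abs_mul, abs_of_nonneg (hb0 t), abs_of_nonneg (sub_nonneg.2 (hb1 t))]
      refine add_le_add ?_ (mul_le_of_le_one_left (abs_nonneg _) (by linarith [hb0 t]))
      rcases Nat.eq_zero_or_pos t with rfl | ht
      · simp [h.m_zero]
      · exact mul_le_mul_of_nonneg_right (hbβ t ht) (abs_nonneg _)
    have e4 : β₁ * |(s t).m i| ≤ τ * K * r := by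
      have hβτ : β₁ = τ * √β₂ := by rw [hτdef]; field_simp
      calc β₁ * |(s t).m i| ≤ β₁ * (K * √((s t).v i)) := mul_le_mul_of_nonneg_left ih hβ₁
        _ = τ * K * (√β₂ * √((s t).v i)) := by rw [hβτ]; ring
        _ ≤ τ * K * r := mul_le_mul_of_nonneg_left e1 (by positivity)
    have e5 : |g t i| ≤ (1 - τ) * K * r := by
      have : (1 - τ) * K = 1 / √(1 - β₂) := by rw [hK]; field_simp
      rw [this, one_div, ← div_eq_inv_mul, le_div_iff₀ hs1, mul_comm]
      exact e2
    linarith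

/-- The squared dual norm of the momentum is bounded independently of the lower bound on the
initial scaling. -/
lemma sum_m_sq_div_le (h : Trajectory X A b β₂ β₃ x₀ q s g) (hb0 : ∀ t, 0 ≤ b t)
    (hb1 : ∀ t, b t ≤ 1) (hbβ : ∀ t, 1 ≤ t → b t ≤ β₁) (hβ₁ : 0 ≤ β₁) (hβ₂ : 0 < β₂)
    (hβ₂' : β₂ < 1) (hβ₃ : 0 ≤ β₃) (hβ₃' : β₃ < 1) (hτ : β₁ / √β₂ < 1) (hq : ∀ i, 0 < q i)
    (hG : ∀ t, ‖g t‖ ≤ G) (t : ℕ) :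
    ∑ i, ((s (t + 1)).m i) ^ 2 / (s (t + 1)).weights i ≤
      1 / ((1 - β₁ / √β₂) * √(1 - β₂)) / √(1 - β₃) * (d * G) := by
  set K := 1 / ((1 - β₁ / √β₂) * √(1 - β₂)) with hK
  have hK0 : 0 ≤ K := by
    have : 0 < 1 - β₁ / √β₂ := by linarith
    positivity
  have hs3 : 0 < √(1 - β₃) := Real.sqrt_pos.2 (by linarith)
  have hterm : ∀ i, ((s (t + 1)).m i) ^ 2 / (s (t + 1)).weights i ≤ K / √(1 - β₃) * G := by
    intro i
    have hw := h.weights_pos hβ₃'.le hq (t + 1) i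
    have e1 := h.abs_m_le hb0 hb1 hbβ hβ₁ hβ₂ hβ₂' hτ (t + 1) i
    have e2 : √(1 - β₃) * √((s (t + 1)).v i) ≤ (s (t + 1)).weights i := by
      rw [← Real.sqrt_mul (by linarith), State.weights]
      refine Real.sqrt_le_sqrt ?_
      rw [h.vhat_succ, nextVhat]
      have h1 := (hq i).le.trans (h.le_vhat hβ₃'.le t i)
      nlinarith [le_max_right ((s t).vhat i) ((s (t + 1)).v i), mul_nonneg hβ₃ h1]
    have e3 : |(s (t + 1)).m i| ≤ G :=
      (PiLp.norm_apply_le _ i).trans (h.norm_m_le hb0 hb1 hG (t + 1))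
    rw [div_le_iff₀ hw, ← sq_abs, sq]
    calc |(s (t + 1)).m i| * |(s (t + 1)).m i| ≤ G * (K * √((s (t + 1)).v i)) :=
          mul_le_mul e3 e1 (abs_nonneg _) ((abs_nonneg _).trans e3)
      _ = K / √(1 - β₃) * G * (√(1 - β₃) * √((s (t + 1)).v i)) := by field_simp
      _ ≤ _ := by
        refine mul_le_mul_of_nonneg_left e2 (mul_nonneg (by positivity) ?_)
        exact (norm_nonneg _).trans (hG 0)
  refine (Finset.sum_le_sum fun i _ => hterm i).trans (le_of_eq ?_)
  simp
  ring

end Trajectory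

/-! ### Descent of the envelope along a trajectory -/

lemma abs_inner_le_of_abs_le {a z : EuclideanSpace ℝ (Fin d)} {c D : ℝ} (ha : ∀ i, |a i| ≤ c)
    (hz : ∀ i, |z i| ≤ D) : |inner ℝ a z| ≤ d * (c * D) := by
  rw [PiLp.inner_apply]
  refine (Finset.abs_sum_le_sum_abs _ _).trans ?_
  have : ∀ i ∈ Finset.univ, |inner ℝ (a i) (z i)| ≤ c * D := fun i _ => by
    have h1 : inner ℝ (a i) (z i) = z i * a i := by simp
    rw [h1, abs_mul, mul_comm]
    exact mul_le_mul (ha i) (hz i) (abs_nonneg _) ((abs_nonneg _).trans (ha i))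
  refine (Finset.sum_le_sum this).trans (le_of_eq ?_)
  simp

lemma norm_le_of_abs_le {z : EuclideanSpace ℝ (Fin d)} {D : ℝ} (hD : 0 ≤ D)
    (hz : ∀ i, |z i| ≤ D) : ‖z‖ ≤ d * D := by
  have h1 := abs_inner_le_of_abs_le hz hz
  rw [real_inner_self_eq_norm_sq, abs_of_nonneg (sq_nonneg _)] at h1
  rcases Nat.eq_zero_or_pos d with rfl | hd
  · have : z = 0 := Subsingleton.elim _ _
    simp [this]
  · have hd' : (1 : ℝ) ≤ d := by exact_mod_cast hd
    refine abs_le_of_sq_le_sq' ?_ (by positivity) |>.2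
    nlinarith [mul_nonneg hD hD, mul_nonneg (mul_nonneg hD hD) (by linarith : (0:ℝ) ≤ d)]

variable {f : EuclideanSpace ℝ (Fin d) → ℝ}

/-- One step of the method changes the envelope by at most a linear term in the momentum, a second
order term, and the increase of the scaling. The linear term is evaluated at the proximal point for
the scaling of the *previous* iteration, which does not depend on the current sample. -/
lemma envelope_step {ρ A D : ℝ} (hρ : 0 ≤ ρ) (hX : Convex ℝ X) (hXc : IsCompact X)
    {w w' : Fin d → ℝ} (hww : ∀ i, w i ≤ w' i) (hw' : ∀ i, 0 < w' i)
    {x m y x' y' : EuclideanSpace ℝ (Fin d)} (hy : IsProx X f ρ w x y)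
    (hx' : x' = proj X w' (x - WithLp.toLp 2 fun i => A * ((w' i)⁻¹ * m i)))
    (hy' : IsProx X f ρ w' x' y') (hD : ∀ i, |(x - y) i| ≤ D) :
    f y' + ρ * diagNormSq w' (x' - y') ≤ f y + ρ * diagNormSq w (x - y)
      + ρ * (D ^ 2 * (∑ i, w' i - ∑ i, w i)) - 2 * ρ * A * inner ℝ m (x - y)
      + ρ * A ^ 2 * ∑ i, (m i) ^ 2 / w' i := by
  have hp := isProx_prox hXc ⟨y, hy.1⟩ continuous_const 1 w'
    (x - WithLp.toLp 2 fun i => A * ((w' i)⁻¹ * m i)) (f := fun _ => (0 : ℝ))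
  rw [← proj_eq_prox, ← hx'] at hp
  -- the projection does not increase the distance to `y`
  have h1 := hp.growth weaklyConvex_zero hX hy.1
  have h1' := diagNormSq_nonneg (fun i => (hw' i).le)
    (x - (WithLp.toLp 2 fun i => A * ((w' i)⁻¹ * m i)) - x')
  have h2 : diagNormSq w' (x - (WithLp.toLp 2 fun i => A * ((w' i)⁻¹ * m i)) - y) =
      diagNormSq w' (x - y) - 2 * A * inner ℝ m (x - y) + A ^ 2 * ∑ i, (m i) ^ 2 / w' i := by
    simp only [diagNormSq, PiLp.inner_apply, Finset.mul_sum, ← Finset.sum_add_distrib,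
      ← Finset.sum_sub_distrib]
    refine Finset.sum_congr rfl fun i _ => ?_
    have := (hw' i).ne'
    simp
    field_simp
    ring
  have h3 := hy'.2 y hy.1
  have h4 := diagNormSq_le_add hww hD
  have h5 : diagNormSq w' (x' - y) ≤ diagNormSq w (x - y) + D ^ 2 * (∑ i, w' i - ∑ i, w i)
      - 2 * A * inner ℝ m (x - y) + A ^ 2 * ∑ i, (m i) ^ 2 / w' i := by
    linarith
  have h6 := mul_le_mul_of_nonneg_left h5 hρ
  linarith

/-- The deterministic regret bound: along every trajectory with estimates of norm at most `G`, the
sum of the inner products of the estimates with the displacements `x_t - y_t` to the proximal points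
is bounded. The right-hand side collects the decrease of the envelope, the total growth of the
scaling, the effect of the momentum and the second order terms. -/
lemma Trajectory.sum_inner_le {ρ A D L G qmax β₁ β₂ β₃ B : ℝ} {b : ℕ → ℝ}
    {x₀ : EuclideanSpace ℝ (Fin d)} {q : Fin d → ℝ} {s : ℕ → State d}
    {g : ℕ → EuclideanSpace ℝ (Fin d)} (h : Trajectory X A b β₂ β₃ x₀ q s g) (hρ : 0 ≤ ρ)
    (hA : 0 ≤ A) (hD : 0 ≤ D) (hL : 0 ≤ L)
    (hX : Convex ℝ X) (hXc : IsCompact X) (hx₀ : x₀ ∈ X)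
    (hXD : ∀ x ∈ X, ∀ y ∈ X, ∀ i, |x i - y i| ≤ D)
    (hf : Continuous f) (hfL : ∀ x ∈ X, ∀ y ∈ X, |f x - f y| ≤ L * ‖x - y‖)
    (hb0 : ∀ t, 0 ≤ b t) (hb1 : ∀ t, b t ≤ 1) (hbβ : ∀ t, 1 ≤ t → b t ≤ β₁)
    (hβ₁ : 0 ≤ β₁) (hβ₂ : 0 < β₂) (hβ₂' : β₂ < 1) (hβ₃ : 0 ≤ β₃) (hβ₃' : β₃ < 1)
    (hτ : β₁ / √β₂ < 1) (hq : ∀ i, 0 < q i) (hqmax : ∀ i, q i ≤ qmax) (hG : ∀ t, ‖g t‖ ≤ G)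
    (n : ℕ) (hB : ∑ t ∈ Finset.range n, b t ≤ B) :
    2 * ρ * A * ∑ t ∈ Finset.range n,
        inner ℝ (g t) ((s t).x - prox X f ρ (s t).weights (s t).x) ≤
      L * (d * D) + ρ * (D ^ 2 * (d * max (√qmax) G)) + 2 * ρ * A * (d * (2 * G * D)) * B
        + n * (ρ * A ^ 2 * (1 / ((1 - β₁ / √β₂) * √(1 - β₂)) / √(1 - β₃) * (d * G))) := by
  set Q := 1 / ((1 - β₁ / √β₂) * √(1 - β₂)) / √(1 - β₃) * (d * G) with hQ
  set y : ℕ → EuclideanSpace ℝ (Fin d) := fun t => prox X f ρ (s t).weights (s t).x with hy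
  have hspec : ∀ t, IsProx X f ρ (s t).weights (s t).x (y t) := fun t =>
    isProx_prox hXc ⟨x₀, hx₀⟩ hf ρ _ _
  have hxm := h.x_mem hXc hx₀
  have hxy : ∀ t i, |((s t).x - y t) i| ≤ D := fun t i => hXD _ (hxm t) _ (hspec t).1 i
  have hG0 : 0 ≤ G := (norm_nonneg _).trans (hG 0)
  set Φ : ℕ → ℝ := fun t => f (y t) + ρ * diagNormSq (s t).weights ((s t).x - y t) with hΦ
  set W : ℕ → ℝ := fun t => ∑ i, (s t).weights i with hW
  have hstep : ∀ t, 2 * ρ * A * inner ℝ (g t) ((s t).x - y t) ≤ (Φ t - Φ (t + 1))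
      + ρ * D ^ 2 * (W (t + 1) - W t) + 2 * ρ * A * (d * (2 * G * D)) * b t + ρ * A ^ 2 * Q := by
    intro t
    have h1 := envelope_step (f := f) hρ hX hXc (h.weights_le_succ hβ₃'.le t)
      (h.weights_pos hβ₃'.le hq (t + 1)) (hspec t) (h.x_succ t) (hspec (t + 1)) (hxy t)
    have h2 := h.sum_m_sq_div_le hb0 hb1 hbβ hβ₁ hβ₂ hβ₂' hβ₃ hβ₃' hτ hq hG t
    have h3 : inner ℝ (s (t + 1)).m ((s t).x - y t) = inner ℝ (g t) ((s t).x - y t)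
        - b t * inner ℝ (g t - (s t).m) ((s t).x - y t) := by
      rw [h.m_succ, nextM, inner_add_left, inner_smul_left, inner_smul_left, inner_sub_left]
      simp
      ring
    have h4 : inner ℝ (g t - (s t).m) ((s t).x - y t) ≤ d * (2 * G * D) := by
      refine (le_abs_self _).trans (abs_inner_le_of_abs_le (fun i => ?_) (hxy t))
      have := (PiLp.norm_apply_le (g t - (s t).m) i).trans (norm_sub_le _ _)
      rw [Real.norm_eq_abs] at this
      linarith [hG t, h.norm_m_le hb0 hb1 hG t]
    have h5 := mul_le_mul_of_nonneg_left h4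
      (mul_nonneg (mul_nonneg (mul_nonneg zero_le_two hρ) hA) (hb0 t))
    have h6 := mul_le_mul_of_nonneg_left h2 (mul_nonneg hρ (sq_nonneg A))
    rw [h3] at h1
    simp only [hΦ, hW]
    linarith
  have hsum := Finset.sum_le_sum fun t (_ : t ∈ Finset.range n) => hstep t
  simp only [Finset.sum_add_distrib, ← Finset.mul_sum, Finset.sum_range_sub,
    Finset.sum_range_sub', Finset.sum_const, Finset.card_range, nsmul_eq_mul] at hsum
  have e1 : Φ 0 - Φ n ≤ L * (d * D) := by
    have h1 : Φ 0 ≤ f (s 0).x := by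
      have := (hspec 0).2 (s 0).x (hxm 0)
      simpa [hΦ, diagNormSq] using this
    have h2 : f (y n) ≤ Φ n := le_add_of_nonneg_right (mul_nonneg hρ
      (diagNormSq_nonneg (fun i => (h.weights_pos hβ₃'.le hq n i).le) _))
    have h3 := (le_abs_self _).trans (hfL _ (hxm 0) _ (hspec n).1)
    have h4 := mul_le_mul_of_nonneg_left
      (norm_le_of_abs_le hD (z := (s 0).x - y n) fun i => hXD _ (hxm 0) _ (hspec n).1 i) hL
    linarith
  have e2 : W n - W 0 ≤ d * max (√qmax) G := by
    have h1 : 0 ≤ W 0 := Finset.sum_nonneg fun i _ => (h.weights_pos hβ₃'.le hq 0 i).le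
    have h2 : W n ≤ ∑ _i : Fin d, max (√qmax) G := Finset.sum_le_sum fun i _ =>
      h.weights_le hβ₂.le hβ₂'.le hβ₃ hβ₃'.le hqmax hG n i
    simp only [Finset.sum_const, Finset.card_univ, Fintype.card_fin, nsmul_eq_mul] at h2
    linarith
  have e3 := mul_le_mul_of_nonneg_left e2 (mul_nonneg hρ (sq_nonneg D))
  have e4 : 2 * ρ * A * (d * (2 * G * D)) * ∑ t ∈ Finset.range n, b t ≤
      2 * ρ * A * (d * (2 * G * D)) * B := mul_le_mul_of_nonneg_left hB (by positivity)
  linarith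

/-- With the final scaling in place of the previous one, the distances to the proximal points grow
by at most a telescoping sum. -/
lemma Trajectory.sum_diagNormSq_le {ρ A D G qmax β₂ β₃ : ℝ} {b : ℕ → ℝ}
    {x₀ : EuclideanSpace ℝ (Fin d)} {q : Fin d → ℝ} {s : ℕ → State d}
    {g : ℕ → EuclideanSpace ℝ (Fin d)} (h : Trajectory X A b β₂ β₃ x₀ q s g) (hρ : 0 < ρ)
    (hX : Convex ℝ X) (hXc : IsCompact X) (hx₀ : x₀ ∈ X)
    (hXD : ∀ x ∈ X, ∀ y ∈ X, ∀ i, |x i - y i| ≤ D)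
    (hf : WeaklyConvex ρ (fun i => √(q i)) f)
    (hβ₂ : 0 < β₂) (hβ₂' : β₂ < 1) (hβ₃ : 0 ≤ β₃) (hβ₃' : β₃ < 1)
    (hq : ∀ i, 0 < q i) (hqmax : ∀ i, q i ≤ qmax) (hG : ∀ t, ‖g t‖ ≤ G) (n : ℕ) :
    ∑ t ∈ Finset.range n, diagNormSq (s (t + 1)).weights
        ((s t).x - prox X f ρ (s (t + 1)).weights (s t).x) ≤
      2 * ∑ t ∈ Finset.range n, diagNormSq (s t).weights
        ((s t).x - prox X f ρ (s t).weights (s t).x) + 5 * (D ^ 2 * (d * max (√qmax) G)) := by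
  have hspec : ∀ t x, IsProx X f ρ (s t).weights x (prox X f ρ (s t).weights x) := fun t x =>
    isProx_prox hXc ⟨x₀, hx₀⟩ hf.continuous ρ _ _
  have hxm := h.x_mem hXc hx₀
  have hterm : ∀ t ∈ Finset.range n, diagNormSq (s (t + 1)).weights
        ((s t).x - prox X f ρ (s (t + 1)).weights (s t).x) ≤
      2 * diagNormSq (s t).weights ((s t).x - prox X f ρ (s t).weights (s t).x)
        + 5 * (D ^ 2 * (∑ i, (s (t + 1)).weights i - ∑ i, (s t).weights i)) := fun t _ =>
    (hspec t (s t).x).diagNormSq_le_of_le hρ hf hX (fun i => (h.weights_pos hβ₃'.le hq t i).le)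
      (h.le_weights hβ₃'.le t) (h.weights_le_succ hβ₃'.le t) (hspec (t + 1) (s t).x)
      fun i => hXD _ (hxm t) _ (hspec t _).1 i
  have hsum := Finset.sum_le_sum hterm
  rw [Finset.sum_add_distrib, ← Finset.mul_sum, ← Finset.mul_sum, ← Finset.mul_sum,
    Finset.sum_range_sub (fun t => ∑ i, (s t).weights i)] at hsum
  have h1 : 0 ≤ ∑ i, (s 0).weights i :=
    Finset.sum_nonneg fun i _ => (h.weights_pos hβ₃'.le hq 0 i).le
  have h2 : ∑ i, (s n).weights i ≤ ∑ _i : Fin d, max (√qmax) G := Finset.sum_le_sum fun i _ =>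
    h.weights_le hβ₂.le hβ₂'.le hβ₃ hβ₃'.le hqmax hG n i
  simp only [Finset.sum_const, Finset.card_univ, Fintype.card_fin, nsmul_eq_mul] at h2
  have h3 := mul_le_mul_of_nonneg_left
    (by linarith : ∑ i, (s n).weights i - ∑ i, (s 0).weights i ≤ d * max (√qmax) G) (sq_nonneg D)
  linarith

end Trajectory

/-! ### The stochastic zeroth-order oracle -/

section Oracle

variable {d : ℕ} {Ω : Type*} [MeasurableSpace Ω] {P : Measure Ω}
  {X : Set (EuclideanSpace ℝ (Fin d))} {F : EuclideanSpace ℝ (Fin d) → Ω → ℝ}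
  {f : EuclideanSpace ℝ (Fin d) → ℝ} {ρ L μ : ℝ} {q : Fin d → ℝ}

/-- The standing assumptions: a compact convex constraint set, and a weakly convex objective that is
the mean of a measurable oracle, Lipschitz near the constraint set. -/
structure IsOracle (P : Measure Ω) (X : Set (EuclideanSpace ℝ (Fin d)))
    (F : EuclideanSpace ℝ (Fin d) → Ω → ℝ) (f : EuclideanSpace ℝ (Fin d) → ℝ) (ρ L μ : ℝ)
    (q : Fin d → ℝ) : Prop where
  convex : Convex ℝ X
  isCompact : IsCompact X
  measurable : Measurable (Function.uncurry F)
  integrable : ∀ x, Integrable (F x) P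
  mean : ∀ x, f x = ∫ s, F x s ∂P
  weaklyConvex : WeaklyConvex ρ (fun i => √(q i)) f
  lipschitz : ∀ s, ∀ x ∈ Metric.cthickening μ X, ∀ y ∈ Metric.cthickening μ X,
    |F x s - F y s| ≤ L * ‖x - y‖
  ρ_pos : 0 < ρ
  L_nonneg : 0 ≤ L
  μ_pos : 0 < μ
  q_pos : ∀ i, 0 < q i

namespace IsOracle

lemma continuous (h : IsOracle P X F f ρ L μ q) : Continuous f := h.weaklyConvex.continuous

lemma abs_mean_sub_le [IsProbabilityMeasure P] (h : IsOracle P X F f ρ L μ q) :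
    ∀ x ∈ Metric.cthickening μ X, ∀ y ∈ Metric.cthickening μ X, |f x - f y| ≤ L * ‖x - y‖ := by
  intro x hx y hy
  rw [h.mean, h.mean, ← integral_sub (h.integrable x) (h.integrable y), ← Real.norm_eq_abs]
  have := norm_integral_le_of_norm_le_const (μ := P) (f := fun s => F x s - F y s)
    (C := L * ‖x - y‖) (Eventually.of_forall fun s => by
      rw [Real.norm_eq_abs]; exact h.lipschitz s x hx y hy)
  simpa using this

lemma self_mem_cthickening {x : EuclideanSpace ℝ (Fin d)} (hx : x ∈ X) :
    x ∈ Metric.cthickening μ X := Metric.self_subset_cthickening X hx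

lemma norm_estimator_le (h : IsOracle P X F f ρ L μ q) {x u : EuclideanSpace ℝ (Fin d)}
    (hx : x ∈ X) (hu : ‖u‖ ≤ 1) (ξ : Ω) : ‖estimator F μ x ξ u‖ ≤ d * L := by
  have hμ := h.μ_pos
  have hn : ‖μ • u‖ ≤ μ := by
    rw [norm_smul, Real.norm_of_nonneg hμ.le]
    exact mul_le_of_le_one_right hμ.le hu
  have hmem : x + μ • u ∈ Metric.cthickening μ X :=
    Metric.mem_cthickening_of_dist_le _ x μ X hx (by
      rw [dist_eq_norm, add_sub_cancel_left]; exact hn)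
  have h1 := h.lipschitz ξ _ hmem x (self_mem_cthickening hx)
  rw [add_sub_cancel_left] at h1
  have h2 : |F (x + μ • u) ξ - F x ξ| ≤ L * μ :=
    h1.trans (mul_le_mul_of_nonneg_left hn h.L_nonneg)
  unfold estimator
  rw [norm_smul, norm_mul, Real.norm_of_nonneg (by positivity : 0 ≤ (d : ℝ) / μ), Real.norm_eq_abs]
  calc (d : ℝ) / μ * |F (x + μ • u) ξ - F x ξ| * ‖u‖ ≤ d / μ * (L * μ) * 1 := by
        have := h.L_nonneg
        gcongr
    _ = d * L := by field_simp

lemma measurable_estimator (h : IsOracle P X F f ρ L μ q) {S : Type*} [MeasurableSpace S]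
    {x u : S → EuclideanSpace ℝ (Fin d)} {ξ : S → Ω} (hx : Measurable x) (hu : Measurable u)
    (hξ : Measurable ξ) : Measurable fun ω => estimator F μ (x ω) (ξ ω) (u ω) := by
  unfold estimator
  have h1 : Measurable fun ω => F (x ω + μ • u ω) (ξ ω) :=
    h.measurable.comp ((hx.add (hu.const_smul μ)).prodMk hξ)
  have h2 : Measurable fun ω => F (x ω) (ξ ω) := h.measurable.comp (hx.prodMk hξ)
  exact ((h1.sub h2).const_mul _).smul hu

/-- The estimator is a biased gradient that satisfies the gradient inequality of `f` in expectation,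
with a factor of order one and up to the smoothing error. -/
lemma le_integral_inner_estimator [IsProbabilityMeasure P] (h : IsOracle P X F f ρ L μ q)
    (hd : 1 ≤ d) {w : Fin d → ℝ} (hw : ∀ i, √(q i) ≤ w i) {x y : EuclideanSpace ℝ (Fin d)}
    (hx : x ∈ X) (hy : IsProx X f ρ w x y) :
    ρ / 16 * diagNormSq w (x - y) - d * L * μ ≤
      ∫ z, inner ℝ (estimator F μ x z.1 z.2) (x - y) ∂(P.prod (ballUniform d)) := by
  have hμ := h.μ_pos
  have hρ := h.ρ_pos
  have hint : Integrable (fun z : Ω × EuclideanSpace ℝ (Fin d) =>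
      inner ℝ (estimator F μ x z.1 z.2) (x - y)) (P.prod (ballUniform d)) := by
    refine Integrable.of_bound (C := d * L * ‖x - y‖) ?_ ?_
    · exact ((h.measurable_estimator measurable_const measurable_snd measurable_fst).inner
        measurable_const).aestronglyMeasurable
    · have hae : ∀ᵐ z ∂(P.prod (ballUniform d)), ‖z.2‖ ≤ 1 :=
        Measure.quasiMeasurePreserving_snd.ae ae_norm_le_one_ballUniform
      filter_upwards [hae] with z hz
      refine (norm_inner_le_norm _ _).trans ?_
      exact mul_le_mul_of_nonneg_right (h.norm_estimator_le hx hz z.1) (norm_nonneg _)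
  have h1 : ∫ z, inner ℝ (estimator F μ x z.1 z.2) (x - y) ∂(P.prod (ballUniform d)) =
      -(d / μ * ∫ u, (f (x + μ • u) - f x) * inner ℝ u (y - x) ∂(ballUniform d)) := by
    rw [integral_prod_symm _ hint, ← integral_const_mul, ← integral_neg]
    refine integral_congr_ae (Eventually.of_forall fun u => ?_)
    have e1 : ∀ s, inner ℝ (estimator F μ x s u) (x - y) =
        (F (x + μ • u) s - F x s) * (d / μ * inner ℝ u (x - y)) := fun s => by
      rw [estimator, inner_smul_left]
      simp
      ring
    simp only [e1]
    rw [integral_mul_const, integral_sub (h.integrable _) (h.integrable _), ← h.mean, ← h.mean,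
      ← neg_sub x y, inner_neg_right]
    ring
  have h2 := integral_two_point_le h.weaklyConvex hμ h.abs_mean_sub_le h.L_nonneg hx hy.1
  have h3 := le_integral_kernel hd
  have h4 := integral_kernel_le (d := d)
  set k := ∫ u, kernel u ∂(ballUniform d) with hk
  have h5 := mul_le_mul_of_nonneg_left h2 (by positivity : 0 ≤ (d : ℝ) / μ)
  have h6 : (d : ℝ) / μ * (μ * (k *
      (f y - f x + ρ / 2 * diagNormSq (fun i => √(q i)) (y - x) + 2 * L * μ))) =
      d * k * (f y - f x + ρ / 2 * diagNormSq (fun i => √(q i)) (y - x) + 2 * L * μ) := by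
    field_simp
  rw [h6] at h5
  rw [h1]
  have h7 := hy.2 x hx
  have h8 : diagNormSq w (x - x) = 0 := by simp [diagNormSq]
  have h9 := diagNormSq_mono hw (x - y)
  rw [h8, mul_zero, add_zero] at h7
  rw [diagNormSq_sub_comm _ y x] at h5
  have h10 := diagNormSq_nonneg (fun i => (Real.sqrt_nonneg _).trans (hw i)) (x - y)
  have hdk : 0 ≤ (d : ℝ) * k := by linarith
  have h11 : d * k * (f y - f x + ρ / 2 * diagNormSq (fun i => √(q i)) (x - y) + 2 * L * μ) ≤
      d * k * (-(ρ / 2 * diagNormSq w (x - y)) + 2 * L * μ) := by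
    refine mul_le_mul_of_nonneg_left ?_ hdk
    nlinarith
  have h12 : 1 / 8 * (ρ / 2 * diagNormSq w (x - y)) ≤ d * k * (ρ / 2 * diagNormSq w (x - y)) :=
    mul_le_mul_of_nonneg_right h3 (by positivity)
  have h13 : d * k * (2 * L * μ) ≤ d * (1 / 2) * (2 * L * μ) := by
    have := h.L_nonneg
    gcongr
  linarith

end IsOracle

/-! ### The run of the method as a random trajectory -/

section Run

variable {A β₁ β₂ β₃ : ℝ} {a b : ℕ → ℝ} {x₀ : EuclideanSpace ℝ (Fin d)}

lemma trajectory_run {Ω : Type*} {F : EuclideanSpace ℝ (Fin d) → Ω → ℝ} (ha : ∀ t, a t = A)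
    (ξ : ℕ → Ω) (u : ℕ → EuclideanSpace ℝ (Fin d)) :
    Trajectory X A b β₂ β₃ x₀ q (run X F μ a b β₂ β₃ x₀ q ξ u)
      (fun t => estimator F μ (run X F μ a b β₂ β₃ x₀ q ξ u t).x (ξ t) (u t)) where
  x_zero := rfl
  m_zero := rfl
  v_zero := rfl
  vhat_zero := rfl
  m_succ _ := rfl
  v_succ _ := rfl
  vhat_succ _ := rfl
  x_succ t := by rw [← ha t]; rfl

lemma norm_run_estimator_le (h : IsOracle P X F f ρ L μ q) (hx₀ : x₀ ∈ X) (ha : ∀ t, a t = A)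
    (ξ : ℕ → Ω) {u : ℕ → EuclideanSpace ℝ (Fin d)} (hu : ∀ t, ‖u t‖ ≤ 1) (t : ℕ) :
    ‖estimator F μ (run X F μ a b β₂ β₃ x₀ q ξ u t).x (ξ t) (u t)‖ ≤ d * L :=
  h.norm_estimator_le ((trajectory_run ha ξ u).x_mem h.isCompact hx₀ t) (hu t) (ξ t)

lemma measurable_prox (h : IsOracle P X F f ρ L μ q) (hne : X.Nonempty) {S : Type*}
    [MeasurableSpace S] {w : S → Fin d → ℝ} {x : S → EuclideanSpace ℝ (Fin d)} (hw : Measurable w)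
    (hx : Measurable x) (hwq : ∀ ω i, √(q i) ≤ w ω i) :
    Measurable fun ω => prox X f ρ (w ω) (x ω) := by
  have hc := continuous_prox (c := ρ) (b := fun i => √(q i)) h.weaklyConvex h.convex h.isCompact hne
    h.ρ_pos.le fun i => by
      have := mul_pos h.ρ_pos (Real.sqrt_pos.2 (h.q_pos i))
      linarith
  have := hc.measurable.comp (hw.prodMk hx)
  convert this using 1
  funext ω
  simp only [Function.comp, max_eq_left (hwq ω _)]

lemma measurable_proj (hX : Convex ℝ X) (hXc : IsCompact X) (hne : X.Nonempty)
    (hq : ∀ i, 0 < q i) {S : Type*}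
    [MeasurableSpace S] {w : S → Fin d → ℝ} {x : S → EuclideanSpace ℝ (Fin d)} (hw : Measurable w)
    (hx : Measurable x) (hwq : ∀ ω i, √(q i) ≤ w ω i) :
    Measurable fun ω => proj X (w ω) (x ω) := by
  have hc := continuous_prox (c := 1) (b := fun i => √(q i)) weaklyConvex_zero hX hXc hne
    zero_le_one fun i => by simpa using hq i
  have := hc.measurable.comp (hw.prodMk hx)
  convert this using 1
  funext ω
  simp only [Function.comp, max_eq_left (hwq ω _), proj_eq_prox]

lemma measurable_weights {S : Type*} [mS : MeasurableSpace S] {s : S → State d}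
    (hs : Measurable fun ω => (s ω).vhat) : Measurable fun ω => (s ω).weights := by
  refine measurable_pi_lambda _ fun i => ?_
  exact ((measurable_pi_apply i).comp hs).sqrt

/-- The state at the start of iteration `t` is a measurable function of the first `t` samples. The
measurable space on `S` is arbitrary: it is used for the history, for the sequence of samples and
for the underlying probability space. -/
lemma measurable_run (h : IsOracle P X F f ρ L μ q) (hx₀ : x₀ ∈ X) (ha : ∀ t, a t = A)
    (hβ₃ : β₃ ≤ 1) {S : Type*} [mS : MeasurableSpace S] (ξ : ℕ → S → Ω)
    (u : ℕ → S → EuclideanSpace ℝ (Fin d)) (t : ℕ) (hξ : ∀ s < t, Measurable (ξ s))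
    (hu : ∀ s < t, Measurable (u s)) :
    Measurable (fun ω => (run X F μ a b β₂ β₃ x₀ q (fun s => ξ s ω) (fun s => u s ω) t).x) ∧
    Measurable (fun ω => (run X F μ a b β₂ β₃ x₀ q (fun s => ξ s ω) (fun s => u s ω) t).m) ∧
    Measurable (fun ω => (run X F μ a b β₂ β₃ x₀ q (fun s => ξ s ω) (fun s => u s ω) t).v) ∧
    Measurable (fun ω => (run X F μ a b β₂ β₃ x₀ q (fun s => ξ s ω) (fun s => u s ω) t).vhat) := by
  induction t with
  | zero => exact ⟨measurable_const, measurable_const, measurable_const, measurable_const⟩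
  | succ t ih =>
    obtain ⟨hx, hm, hv, hvh⟩ := ih (fun s hs => hξ s (by omega)) (fun s hs => hu s (by omega))
    have hg := h.measurable_estimator hx (hu t t.lt_succ_self) (hξ t t.lt_succ_self)
    have hm' : Measurable (fun ω =>
        (run X F μ a b β₂ β₃ x₀ q (fun s => ξ s ω) (fun s => u s ω) (t + 1)).m) := by
      simp only [run, step, nextM]
      exact (hm.const_smul (b t)).add (hg.const_smul (1 - b t))
    have hv' : Measurable (fun ω =>
        (run X F μ a b β₂ β₃ x₀ q (fun s => ξ s ω) (fun s => u s ω) (t + 1)).v) := by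
      simp only [run, step]
      unfold nextV
      refine measurable_pi_lambda _ fun i => ?_
      have hgi : Measurable fun ω => (estimator F μ
          (run X F μ a b β₂ β₃ x₀ q (fun s => ξ s ω) (fun s => u s ω) t).x (ξ t ω) (u t ω)) i :=
        (EuclideanSpace.proj (𝕜 := ℝ) i).measurable.comp hg
      exact (((measurable_pi_apply i).comp hv).const_mul _).add ((hgi.pow_const 2).const_mul _)
    have hvh' : Measurable (fun ω =>
        (run X F μ a b β₂ β₃ x₀ q (fun s => ξ s ω) (fun s => u s ω) (t + 1)).vhat) := by
      refine measurable_pi_lambda _ fun i => ?_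
      have h1 := (measurable_pi_apply i).comp hvh
      have h2 := (measurable_pi_apply i).comp hv'
      exact (h1.const_mul _).add ((h1.max h2).const_mul _)
    refine ⟨?_, hm', hv', hvh'⟩
    have hw := measurable_weights hvh'
    have hpt : Measurable fun ω =>
        (run X F μ a b β₂ β₃ x₀ q (fun s => ξ s ω) (fun s => u s ω) t).x - WithLp.toLp 2 (fun i =>
          A * (((run X F μ a b β₂ β₃ x₀ q (fun s => ξ s ω) (fun s => u s ω) (t + 1)).weights i)⁻¹ *
            (run X F μ a b β₂ β₃ x₀ q (fun s => ξ s ω) (fun s => u s ω) (t + 1)).m i)) := by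
      refine hx.sub ((WithLp.measurable_toLp 2 _).comp (measurable_pi_lambda _ fun i => ?_))
      have h1 := (measurable_pi_apply i).comp hw
      have h2 := (EuclideanSpace.proj (𝕜 := ℝ) i).measurable.comp hm'
      exact (h1.inv.mul h2).const_mul A
    have hp := measurable_proj h.convex h.isCompact ⟨x₀, hx₀⟩ h.q_pos hw hpt fun ω i =>
      (trajectory_run ha (fun s => ξ s ω) (fun s => u s ω)).le_weights hβ₃ (t + 1) i
    convert hp using 1
    funext ω
    exact (trajectory_run ha (fun s => ξ s ω) (fun s => u s ω)).x_succ t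

end Run

end Oracle

/-! ### Averaging over independent samples -/

section Independence

variable {S : Type*} [MeasurableSpace S] {Pr : Measure S}

/-- A lower bound on the average over the fresh sample, for each value of the past, integrates to a
lower bound on the expectation. -/
lemma integral_le_integral_of_indepFun [IsProbabilityMeasure Pr] {A B : Type*} [MeasurableSpace A] [MeasurableSpace B]
    {p : S → A} {Z : S → B} (hp : Measurable p) (hZ : Measurable Z) (hind : IndepFun p Z Pr)
    {h : A × B → ℝ} (hh : Measurable h) (hint : Integrable (fun ω => h (p ω, Z ω)) Pr)
    {l : S → ℝ} (hl : Integrable l Pr) (hle : ∀ ω, l ω ≤ ∫ z, h (p ω, z) ∂(Pr.map Z)) :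
    ∫ ω, l ω ∂Pr ≤ ∫ ω, h (p ω, Z ω) ∂Pr := by
  have hmap := (indepFun_iff_map_prod_eq_prod_map_map hp.aemeasurable hZ.aemeasurable).1 hind
  have : IsProbabilityMeasure (Pr.map p) := Measure.isProbabilityMeasure_map hp.aemeasurable
  have : IsProbabilityMeasure (Pr.map Z) := Measure.isProbabilityMeasure_map hZ.aemeasurable
  have hint' : Integrable h ((Pr.map p).prod (Pr.map Z)) := by
    rw [← hmap, integrable_map_measure hh.aestronglyMeasurable (hp.prodMk hZ).aemeasurable]
    exact hint
  have h1 : ∫ ω, h (p ω, Z ω) ∂Pr = ∫ ω, ∫ z, h (p ω, z) ∂(Pr.map Z) ∂Pr := by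
    rw [← integral_map (f := h) (φ := fun ω => (p ω, Z ω)) (hp.prodMk hZ).aemeasurable
      hh.aestronglyMeasurable, hmap, integral_prod _ hint']
    exact integral_map hp.aemeasurable hint'.integral_prod_left.aestronglyMeasurable
  rw [h1]
  refine integral_mono hl ?_ hle
  exact hint'.integral_prod_left.comp_measurable hp

/-- The expectation at an independent random index. -/
lemma integral_random_index {B : Type*} [MeasurableSpace B] {τ : S → ℕ} {Y : S → B}
    (hτ : Measurable τ) (hY : Measurable Y) (hind : IndepFun τ Y Pr) {φ : ℕ → B → ℝ}
    (hφ : ∀ t, Measurable (φ t)) {n : ℕ} (hn : ∀ᵐ ω ∂Pr, τ ω ∈ Finset.range n)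
    (hint : ∀ t ∈ Finset.range n, Integrable (fun ω => φ t (Y ω)) Pr) :
    Integrable (fun ω => φ (τ ω) (Y ω)) Pr ∧
      ∫ ω, φ (τ ω) (Y ω) ∂Pr =
        ∑ t ∈ Finset.range n, Pr.real {ω | τ ω = t} * ∫ ω, φ t (Y ω) ∂Pr := by
  have hset : ∀ t, MeasurableSet {ω | τ ω = t} := fun t => hτ (measurableSet_singleton t)
  have hae : (fun ω => φ (τ ω) (Y ω)) =ᵐ[Pr]
      fun ω => ∑ t ∈ Finset.range n, {ω | τ ω = t}.indicator (fun ω => φ t (Y ω)) ω := by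
    filter_upwards [hn] with ω hω
    rw [Finset.sum_eq_single_of_mem (τ ω) hω]
    · rw [Set.indicator_of_mem (by simp)]
    · intro t _ ht
      rw [Set.indicator_of_notMem]
      exact fun h => ht h.symm
  have hi : ∀ t ∈ Finset.range n,
      Integrable (fun ω => {ω | τ ω = t}.indicator (fun ω => φ t (Y ω)) ω) Pr := fun t ht =>
    (hint t ht).indicator (hset t)
  refine ⟨(integrable_finsetSum _ hi).congr hae.symm, ?_⟩
  rw [integral_congr_ae hae, integral_finsetSum _ hi]
  refine Finset.sum_congr rfl fun t _ => ?_
  have hone : Measurable fun k : ℕ => if k = t then (1 : ℝ) else 0 := measurable_from_top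
  have h1 := (hind.comp hone (hφ t)).integral_fun_mul_eq_mul_integral
    (hone.comp hτ).aestronglyMeasurable ((hφ t).comp hY).aestronglyMeasurable
  have h2 : ∫ ω, ((fun k : ℕ => if k = t then (1 : ℝ) else 0) ∘ τ) ω ∂Pr =
      Pr.real {ω | τ ω = t} := by
    rw [← integral_indicator_one (hset t)]
    refine integral_congr_ae (Eventually.of_forall fun ω => ?_)
    simp [Set.indicator_apply]
  rw [h2] at h1
  refine Eq.trans (integral_congr_ae (Eventually.of_forall fun ω => ?_)) h1
  simp [Set.indicator_apply]

end Independence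

/-! ### The expected distance to the proximal points -/

section Expectation

variable {d : ℕ}

/-- The squared scaled distance from `x` to its scaled proximal point. Up to the factor `4ρ²` it is
the squared dual norm of the gradient of the envelope. -/
def gap (X : Set (EuclideanSpace ℝ (Fin d))) (f : EuclideanSpace ℝ (Fin d) → ℝ) (ρ : ℝ)
    (w : Fin d → ℝ) (x : EuclideanSpace ℝ (Fin d)) : ℝ :=
  diagNormSq w (x - prox X f ρ w x)

lemma diagNormSq_le_of_abs_le {w : Fin d → ℝ} {M D : ℝ} (hw : ∀ i, 0 ≤ w i) (hM : ∀ i, w i ≤ M)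
    {z : EuclideanSpace ℝ (Fin d)} (hz : ∀ i, |z i| ≤ D) :
    diagNormSq w z ≤ d * (M * D ^ 2) := by
  have : ∀ i ∈ Finset.univ, w i * z i ^ 2 ≤ M * D ^ 2 := fun i _ => by
    have h1 : (z i) ^ 2 ≤ D ^ 2 := sq_le_sq' (by linarith [neg_abs_le (z i), hz i])
      ((le_abs_self _).trans (hz i))
    exact mul_le_mul (hM i) h1 (sq_nonneg _) ((hw i).trans (hM i))
  refine (Finset.sum_le_sum this).trans (le_of_eq ?_)
  simp

variable {Ω : Type*} [MeasurableSpace Ω] {P : Measure Ω}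
  {X : Set (EuclideanSpace ℝ (Fin d))} {F : EuclideanSpace ℝ (Fin d) → Ω → ℝ}
  {f : EuclideanSpace ℝ (Fin d) → ℝ} {ρ L μ : ℝ} {q : Fin d → ℝ}
  {A D B qmax β₁ β₂ β₃ : ℝ} {a b : ℕ → ℝ} {x₀ : EuclideanSpace ℝ (Fin d)}
  {S : Type*} [MeasurableSpace S] {Pr : Measure S}
  {Z : ℕ → S → Ω × EuclideanSpace ℝ (Fin d)}

/-- The state of the method at the start of iteration `t`, as a function of the sequence of
samples. -/
def stateAt (X : Set (EuclideanSpace ℝ (Fin d))) (F : EuclideanSpace ℝ (Fin d) → Ω → ℝ) (μ : ℝ)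
    (a b : ℕ → ℝ) (β₂ β₃ : ℝ) (x₀ : EuclideanSpace ℝ (Fin d)) (q : Fin d → ℝ) (t : ℕ)
    (z : ℕ → Ω × EuclideanSpace ℝ (Fin d)) : State d :=
  run X F μ a b β₂ β₃ x₀ q (fun s => (z s).1) (fun s => (z s).2) t

lemma gap_nonneg {w : Fin d → ℝ}
    (hw : ∀ i, √(q i) ≤ w i) (x : EuclideanSpace ℝ (Fin d)) : 0 ≤ gap X f ρ w x :=
  diagNormSq_nonneg (fun i => (Real.sqrt_nonneg _).trans (hw i)) _

lemma measurable_gap (h : IsOracle P X F f ρ L μ q) (hne : X.Nonempty) {S : Type*}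
    [MeasurableSpace S] {w : S → Fin d → ℝ} {x : S → EuclideanSpace ℝ (Fin d)} (hw : Measurable w)
    (hx : Measurable x) (hwq : ∀ ω i, √(q i) ≤ w ω i) :
    Measurable fun ω => gap X f ρ (w ω) (x ω) :=
  continuous_diagNormSq.measurable.comp
    (hw.prodMk (hx.sub (measurable_prox h hne hw hx hwq)))

lemma measurable_gap_stateAt (h : IsOracle P X F f ρ L μ q) (hx₀ : x₀ ∈ X) (ha : ∀ t, a t = A)
    (hβ₃ : β₃ ≤ 1) (s t : ℕ) :
    Measurable fun z => gap X f ρ (stateAt X F μ a b β₂ β₃ x₀ q s z).weights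
      (stateAt X F μ a b β₂ β₃ x₀ q t z).x := by
  have hm := fun t => measurable_run (b := b) (β₂ := β₂) h hx₀ ha hβ₃
    (fun s (z : ℕ → Ω × EuclideanSpace ℝ (Fin d)) => (z s).1) (fun s z => (z s).2) t
    (fun s _ => (measurable_pi_apply s).fst) (fun s _ => (measurable_pi_apply s).snd)
  exact measurable_gap h ⟨x₀, hx₀⟩ (measurable_weights (hm s).2.2.2) (hm t).1 fun z i =>
    (trajectory_run ha _ _).le_weights hβ₃ s i

lemma gap_le (h : IsOracle P X F f ρ L μ q) (hx₀ : x₀ ∈ X)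
    (hXD : ∀ x ∈ X, ∀ y ∈ X, ∀ i, |x i - y i| ≤ D) {w : Fin d → ℝ} {M : ℝ}
    (hw : ∀ i, 0 ≤ w i) (hM : ∀ i, w i ≤ M) {x : EuclideanSpace ℝ (Fin d)} (hx : x ∈ X) :
    gap X f ρ w x ≤ d * (M * D ^ 2) :=
  diagNormSq_le_of_abs_le hw hM fun i =>
    hXD x hx _ (isProx_prox h.isCompact ⟨x₀, hx₀⟩ h.continuous ρ w x).1 i

lemma ae_norm_snd_le_one (hZ : ∀ t, Measurable (Z t))
    (hlaw : ∀ t, Pr.map (Z t) = P.prod (ballUniform d)) : ∀ᵐ ω ∂Pr, ∀ t, ‖(Z t ω).2‖ ≤ 1 := by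
  refine ae_all_iff.2 fun t => ?_
  have h1 : ∀ᵐ z ∂(Pr.map (Z t)), ‖z.2‖ ≤ 1 := by
    rw [hlaw]
    exact Measure.quasiMeasurePreserving_snd.ae ae_norm_le_one_ballUniform
  exact ae_of_ae_map (hZ t).aemeasurable h1

/-- The current sample is independent of the state at the start of the iteration. -/
lemma indepFun_stateAt (h : IsOracle P X F f ρ L μ q) (hx₀ : x₀ ∈ X) (ha : ∀ t, a t = A)
    (hβ₃ : β₃ ≤ 1) (hZ : ∀ t, Measurable (Z t)) (hind : iIndepFun Z Pr) (t : ℕ) :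
    IndepFun (fun ω => ((stateAt X F μ a b β₂ β₃ x₀ q t fun s => Z s ω).weights,
      (stateAt X F μ a b β₂ β₃ x₀ q t fun s => Z s ω).x)) (Z t) Pr := by
  have h1 := indep_iSup_of_disjoint (fun i => (hZ i).comap_le) hind.iIndep
    (S := {s | s < t}) (T := {t}) (by simp)
  rw [iSup_singleton] at h1
  rw [IndepFun_iff_Indep]
  refine indep_of_indep_of_le_left h1 ?_
  set 𝓕 : MeasurableSpace S := ⨆ i ∈ {s | s < t}, MeasurableSpace.comap (Z i) inferInstance with h𝓕
  have hZ𝓕 : ∀ s < t, Measurable[𝓕] (Z s) := fun s hs =>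
    (comap_measurable (Z s)).mono
      (le_iSup₂ (f := fun i (_ : i ∈ {s | s < t}) => MeasurableSpace.comap (Z i) inferInstance)
        s hs) le_rfl
  have hm := measurable_run (mS := 𝓕) (b := b) (β₂ := β₂) h hx₀ ha hβ₃
    (fun s ω => (Z s ω).1) (fun s ω => (Z s ω).2) t
    (fun s hs => measurable_fst.comp (hZ𝓕 s hs)) (fun s hs => measurable_snd.comp (hZ𝓕 s hs))
  exact (Measurable.prodMk (measurable_weights (mS := 𝓕) hm.2.2.2) hm.1).comap_le

/-- In expectation, the inner product of the estimate with `x_t - y_t` dominates the squared distance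
of `x_t` to its proximal point `y_t` for the previous scaling. -/
lemma integral_gap_le_integral_inner [IsProbabilityMeasure P] [IsProbabilityMeasure Pr]
    (h : IsOracle P X F f ρ L μ q) (hd : 1 ≤ d) (hx₀ : x₀ ∈ X)
    (ha : ∀ t, a t = A) (hβ₃ : β₃ ≤ 1) (hZ : ∀ t, Measurable (Z t))
    (hlaw : ∀ t, Pr.map (Z t) = P.prod (ballUniform d)) (hind : iIndepFun Z Pr) {t : ℕ}
    {s : S → State d} (hs : ∀ ω, s ω = stateAt X F μ a b β₂ β₃ x₀ q t fun r => Z r ω)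
    (hint : Integrable (fun ω => gap X f ρ (s ω).weights (s ω).x) Pr) :
    Integrable (fun ω => inner ℝ (estimator F μ (s ω).x (Z t ω).1 (Z t ω).2)
        ((s ω).x - prox X f ρ (s ω).weights (s ω).x)) Pr ∧
      ρ / 16 * ∫ ω, gap X f ρ (s ω).weights (s ω).x ∂Pr - d * L * μ ≤
        ∫ ω, inner ℝ (estimator F μ (s ω).x (Z t ω).1 (Z t ω).2)
          ((s ω).x - prox X f ρ (s ω).weights (s ω).x) ∂Pr := by
  have hs' : s = fun ω => stateAt X F μ a b β₂ β₃ x₀ q t fun r => Z r ω := funext hs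
  have hne : X.Nonempty := ⟨x₀, hx₀⟩
  have hwq : ∀ ω i, √(q i) ≤ (s ω).weights i := fun ω i => by
    rw [hs]; exact (trajectory_run ha _ _).le_weights hβ₃ t i
  have hxX : ∀ ω, (s ω).x ∈ X := fun ω => by
    rw [hs]; exact (trajectory_run ha _ _).x_mem h.isCompact hx₀ t
  have hm := measurable_run (b := b) (β₂ := β₂) h hx₀ ha hβ₃
    (fun s ω => (Z s ω).1) (fun s ω => (Z s ω).2) t (fun s _ => (hZ s).fst) (fun s _ => (hZ s).snd)
  have hmx : Measurable fun ω => (s ω).x := by rw [hs']; exact hm.1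
  have hmw : Measurable fun ω => (s ω).weights := by
    rw [hs']; exact measurable_weights hm.2.2.2
  have hindt := indepFun_stateAt (b := b) (β₂ := β₂) h hx₀ ha hβ₃ hZ hind t
  -- the scaling is cut off from below so that the integrand is measurable on the whole space
  set H : ((Fin d → ℝ) × EuclideanSpace ℝ (Fin d)) × (Ω × EuclideanSpace ℝ (Fin d)) → ℝ :=
    fun p => inner ℝ (estimator F μ p.1.2 p.2.1 p.2.2)
      (p.1.2 - prox X f ρ (fun i => max (p.1.1 i) (√(q i))) p.1.2) with hH
  have hHm : Measurable H := by
    have h1 : Measurable fun p : ((Fin d → ℝ) × EuclideanSpace ℝ (Fin d)) ×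
        (Ω × EuclideanSpace ℝ (Fin d)) => p.1.2 := measurable_fst.snd
    refine (h.measurable_estimator h1 measurable_snd.snd measurable_snd.fst).inner
      (h1.sub (measurable_prox h hne ?_ h1 fun _ i => le_max_right _ _))
    exact measurable_pi_lambda _ fun i =>
      ((measurable_pi_apply i).comp measurable_fst.fst).max measurable_const
  have hHeq : ∀ ω z, H (((s ω).weights, (s ω).x), z) =
      inner ℝ (estimator F μ (s ω).x z.1 z.2)
        ((s ω).x - prox X f ρ (s ω).weights (s ω).x) := fun ω z => by
    simp only [hH, max_eq_left (hwq ω _)]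
  have hD : ∃ D, ∀ x ∈ X, ∀ y ∈ X, ‖x - y‖ ≤ D := by
    obtain ⟨C, hC⟩ := Metric.isBounded_iff.1 h.isCompact.isBounded
    exact ⟨C, fun x hx y hy => by rw [← dist_eq_norm]; exact hC hx hy⟩
  obtain ⟨D, hD⟩ := hD
  have hint2 : Integrable (fun ω => H (((s ω).weights, (s ω).x), Z t ω)) Pr := by
    refine Integrable.of_bound (C := d * L * D)
      (hHm.comp ((hmw.prodMk hmx).prodMk (hZ t))).aestronglyMeasurable ?_
    filter_upwards [ae_norm_snd_le_one hZ hlaw] with ω hω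
    rw [hHeq]
    refine (norm_inner_le_norm _ _).trans ?_
    exact mul_le_mul (h.norm_estimator_le (hxX ω) (hω t) _)
      (hD _ (hxX ω) _ (isProx_prox h.isCompact hne h.continuous ρ _ _).1) (norm_nonneg _)
      (mul_nonneg (Nat.cast_nonneg _) h.L_nonneg)
  have key := integral_le_integral_of_indepFun (hmw.prodMk hmx) (hZ t)
    (by rw [hs']; exact hindt) hHm hint2
    (l := fun ω => ρ / 16 * gap X f ρ (s ω).weights (s ω).x - d * L * μ)
    ((hint.const_mul _).sub (integrable_const _)) fun ω => by
      simp only [hHeq, hlaw]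
      exact h.le_integral_inner_estimator hd (hwq ω) (hxX ω)
        (isProx_prox h.isCompact hne h.continuous ρ _ _)
  simp only [hHeq] at hint2 key
  refine ⟨hint2, ?_⟩
  rw [integral_sub (hint.const_mul _) (integrable_const _), integral_const_mul] at key
  simpa using key

/-- The sum of the expected squared distances of the iterates to their proximal points. -/
lemma sum_integral_gap_le [IsProbabilityMeasure P] [IsProbabilityMeasure Pr]
    (h : IsOracle P X F f ρ L μ q) (hd : 1 ≤ d) (hx₀ : x₀ ∈ X)
    (ha : ∀ t, a t = A) (hA : 0 < A)
    (hD : 0 ≤ D) (hXD : ∀ x ∈ X, ∀ y ∈ X, ∀ i, |x i - y i| ≤ D)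
    (hb0 : ∀ t, 0 ≤ b t) (hb1 : ∀ t, b t ≤ 1) (hbβ : ∀ t, 1 ≤ t → b t ≤ β₁)
    (hβ₁ : 0 ≤ β₁) (hβ₂ : 0 < β₂) (hβ₂' : β₂ < 1) (hβ₃ : 0 ≤ β₃) (hβ₃' : β₃ < 1)
    (hτ : β₁ / √β₂ < 1) (hqmax : ∀ i, q i ≤ qmax)
    (hZ : ∀ t, Measurable (Z t))
    (hlaw : ∀ t, Pr.map (Z t) = P.prod (ballUniform d)) (hind : iIndepFun Z Pr)
    (n : ℕ) (hB : ∑ t ∈ Finset.range n, b t ≤ B) {s : ℕ → S → State d}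
    (hs : ∀ t ω, s t ω = stateAt X F μ a b β₂ β₃ x₀ q t fun r => Z r ω) :
    (∀ t, Integrable (fun ω => gap X f ρ (s (t + 1) ω).weights (s t ω).x) Pr) ∧
    ∑ t ∈ Finset.range n, ∫ ω, gap X f ρ (s (t + 1) ω).weights (s t ω).x ∂Pr ≤
      2 * (16 / ρ * ((L * (d * D) + ρ * (D ^ 2 * (d * max (√qmax) (d * L)))
        + 2 * ρ * A * (d * (2 * (d * L) * D)) * B
        + n * (ρ * A ^ 2 * (1 / ((1 - β₁ / √β₂) * √(1 - β₂)) / √(1 - β₃) * (d * (d * L)))))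
          / (2 * ρ * A) + n * (d * L * μ))) + 5 * (D ^ 2 * (d * max (√qmax) (d * L))) := by
  have hρ := h.ρ_pos
  have htraj : ∀ ω, Trajectory X A b β₂ β₃ x₀ q (fun t => s t ω)
      (fun t => estimator F μ (s t ω).x (Z t ω).1 (Z t ω).2) := fun ω => by
    simp only [hs]
    exact trajectory_run ha (fun t => (Z t ω).1) (fun t => (Z t ω).2)
  have hgood := ae_norm_snd_le_one hZ hlaw
  have hG : ∀ ω, (∀ t, ‖(Z t ω).2‖ ≤ 1) → ∀ t,
      ‖estimator F μ (s t ω).x (Z t ω).1 (Z t ω).2‖ ≤ d * L := fun ω hω t =>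
    h.norm_estimator_le ((htraj ω).x_mem h.isCompact hx₀ t) (hω t) _
  have hint : ∀ r t, Integrable (fun ω => gap X f ρ (s r ω).weights (s t ω).x) Pr := by
    intro r t
    have hmeas : Measurable fun ω => gap X f ρ (s r ω).weights (s t ω).x := by
      have := (measurable_gap_stateAt (b := b) (β₂ := β₂) h hx₀ ha hβ₃'.le r t).comp
        (measurable_pi_lambda (fun ω t => Z t ω) hZ)
      simp only [hs]
      exact this
    refine Integrable.of_bound (C := d * (max (√qmax) (d * L) * D ^ 2))
      hmeas.aestronglyMeasurable ?_
    filter_upwards [hgood] with ω hω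
    rw [Real.norm_of_nonneg (gap_nonneg ((htraj ω).le_weights hβ₃'.le r) _)]
    exact gap_le h hx₀ hXD (fun i => ((htraj ω).weights_pos hβ₃'.le h.q_pos r i).le)
      ((htraj ω).weights_le hβ₂.le hβ₂'.le hβ₃ hβ₃'.le hqmax (hG ω hω) r)
      ((htraj ω).x_mem h.isCompact hx₀ t)
  refine ⟨fun t => hint (t + 1) t, ?_⟩
  have hstep := fun t => integral_gap_le_integral_inner h hd hx₀ ha hβ₃'.le hZ hlaw hind (t := t)
    (hs t) (hint t t)
  set R := L * (d * D) + ρ * (D ^ 2 * (d * max (√qmax) (d * L)))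
        + 2 * ρ * A * (d * (2 * (d * L) * D)) * B
        + n * (ρ * A ^ 2 * (1 / ((1 - β₁ / √β₂) * √(1 - β₂)) / √(1 - β₃) * (d * (d * L)))) with hR
  -- the deterministic bound on the inner products, in expectation
  have h1 : ∑ t ∈ Finset.range n, ∫ ω, inner ℝ (estimator F μ (s t ω).x (Z t ω).1 (Z t ω).2)
      ((s t ω).x - prox X f ρ (s t ω).weights (s t ω).x) ∂Pr ≤ R / (2 * ρ * A) := by
    rw [← integral_finsetSum _ fun t _ => (hstep t).1]
    have hle := integral_mono_ae (integrable_finsetSum (Finset.range n) fun t _ => (hstep t).1)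
      (integrable_const (R / (2 * ρ * A))) (by
        filter_upwards [hgood] with ω hω
        rw [le_div_iff₀' (by positivity)]
        exact (htraj ω).sum_inner_le hρ.le hA.le hD h.L_nonneg h.convex h.isCompact hx₀ hXD
          h.continuous (fun x hx y hy => h.abs_mean_sub_le x (IsOracle.self_mem_cthickening hx) y
            (IsOracle.self_mem_cthickening hy)) hb0 hb1 hbβ hβ₁ hβ₂ hβ₂' hβ₃ hβ₃' hτ h.q_pos hqmax
          (hG ω hω) n hB)
    simpa using hle
  have h2 := Finset.sum_le_sum fun t (_ : t ∈ Finset.range n) => (hstep t).2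
  rw [Finset.sum_sub_distrib, ← Finset.mul_sum, Finset.sum_const, Finset.card_range,
    nsmul_eq_mul] at h2
  have h3 : ∑ t ∈ Finset.range n, ∫ ω, gap X f ρ (s t ω).weights (s t ω).x ∂Pr ≤
      16 / ρ * (R / (2 * ρ * A) + n * (d * L * μ)) := by
    rw [div_mul_eq_mul_div, le_div_iff₀ hρ]
    linarith
  -- replace the previous scaling by the current one
  have h4 : ∑ t ∈ Finset.range n, ∫ ω, gap X f ρ (s (t + 1) ω).weights (s t ω).x ∂Pr ≤
      2 * ∑ t ∈ Finset.range n, ∫ ω, gap X f ρ (s t ω).weights (s t ω).x ∂Pr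
        + 5 * (D ^ 2 * (d * max (√qmax) (d * L))) := by
    rw [← integral_finsetSum _ fun t _ => hint (t + 1) t,
      ← integral_finsetSum _ fun t _ => hint t t, ← integral_const_mul]
    have hsum := integrable_finsetSum (Finset.range n) fun t _ => hint t t
    have hle := integral_mono_ae
      (integrable_finsetSum (Finset.range n) fun t _ => hint (t + 1) t)
      ((hsum.const_mul 2).add (integrable_const (5 * (D ^ 2 * (d * max (√qmax) (d * L)))))) (by
        filter_upwards [hgood] with ω hω
        exact (htraj ω).sum_diagNormSq_le hρ h.convex h.isCompact hx₀ hXD h.weaklyConvex hβ₂ hβ₂'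
          hβ₃ hβ₃' h.q_pos hqmax (hG ω hω) n)
    simp only [Pi.add_apply] at hle
    rw [integral_add (hsum.const_mul 2) (integrable_const _)] at hle
    simpa using hle
  linarith

end Expectation

/-! ### The convergence rate -/

section Rate

lemma sum_range_momentum_le {β₁ r : ℝ} {b : ℕ → ℝ} (hβ₁ : 0 ≤ β₁) (hr0 : 0 < r) (hr1 : r < 1)
    (hb0 : b 0 < 1) (hb : ∀ t, 1 ≤ t → b t = β₁ * r ^ (t - 1)) (n : ℕ) :
    ∑ t ∈ Finset.range (n + 1), b t ≤ 1 + β₁ / (1 - r) := by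
  rw [Finset.sum_range_succ']
  have h1 : ∀ t ∈ Finset.range n, b (t + 1) = β₁ * r ^ t := fun t _ => by
    rw [hb (t + 1) (by omega), Nat.add_sub_cancel]
  rw [Finset.sum_congr rfl h1, ← Finset.mul_sum, div_eq_mul_inv]
  have h2 : ∑ t ∈ Finset.range n, r ^ t ≤ (1 - r)⁻¹ := by
    rw [← tsum_geometric_of_lt_one hr0.le hr1]
    exact (summable_geometric_of_lt_one hr0.le hr1).sum_le_tsum _ fun t _ => by positivity
  linarith [mul_le_mul_of_nonneg_left h2 hβ₁]

/-- The constant of the rate, in terms of the parameters; `K` bounds the momentum relative to the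
scaling, and `B` bounds the sum of the momentum parameters. -/
def rateConst (ρ L D α qmax K B : ℝ) : ℝ :=
  64 / α * (L * D + ρ * (D ^ 2 * (√qmax + L)) + 4 * ρ * α * L * D * B + ρ * α ^ 2 * K * L)
    + 128 * ρ * L + 20 * ρ ^ 2 * D ^ 2 * (√qmax + L)

/-- With `A = α / √N` and `μ = d / √N`, the averaged bound is of order `d² / √N`. -/
lemma rate_arith {ρ L D α qmax K B : ℝ} (hρ : 0 < ρ) (hL : 0 ≤ L) (hD : 0 ≤ D) (hα : 0 < α)
    (hB : 0 ≤ B) {d N : ℝ} (hd : 1 ≤ d) (hN : 1 ≤ N) {A μ : ℝ}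
    (hA : A = α / √N) (hμ : μ = d / √N) :
    4 * ρ ^ 2 * (1 / N * (2 * (16 / ρ * ((L * (d * D) + ρ * (D ^ 2 * (d * max (√qmax) (d * L)))
        + 2 * ρ * A * (d * (2 * (d * L) * D)) * B + N * (ρ * A ^ 2 * (K * (d * (d * L)))))
          / (2 * ρ * A) + N * (d * L * μ))) + 5 * (D ^ 2 * (d * max (√qmax) (d * L))))) ≤
      rateConst ρ L D α qmax K B * (d ^ 2 / √N) := by
  obtain ⟨s, hs, rfl⟩ : ∃ s : ℝ, 1 ≤ s ∧ N = s ^ 2 :=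
    ⟨√N, Real.one_le_sqrt.2 hN, (Real.sq_sqrt (by linarith)).symm⟩
  have hs0 : 0 < s := by linarith
  have hd0 : 0 < d := by linarith
  rw [Real.sqrt_sq hs0.le] at hA hμ ⊢
  have hdd : d ≤ d ^ 2 := by nlinarith
  have hM : d * max (√qmax) (d * L) ≤ d ^ 2 * (√qmax + L) := by
    have h1 : max (√qmax) (d * L) ≤ d * (√qmax + L) := by
      refine max_le ?_ ?_
      · nlinarith [Real.sqrt_nonneg qmax, mul_nonneg hd0.le hL]
      · nlinarith [mul_nonneg hd0.le (Real.sqrt_nonneg qmax)]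
    nlinarith
  set M' := √qmax + L with hM'
  have hM0 : 0 ≤ M' := add_nonneg (Real.sqrt_nonneg _) hL
  have hA0 : 0 < A := by rw [hA]; positivity
  -- bound the numerator by a multiple of `d²`
  have h1 : L * (d * D) + ρ * (D ^ 2 * (d * max (√qmax) (d * L)))
        + 2 * ρ * A * (d * (2 * (d * L) * D)) * B + s ^ 2 * (ρ * A ^ 2 * (K * (d * (d * L)))) ≤
      (L * D + ρ * (D ^ 2 * M') + 4 * ρ * α * L * D * B + ρ * α ^ 2 * K * L) * d ^ 2 := by
    have e1 : L * (d * D) ≤ L * D * d ^ 2 := by nlinarith [mul_nonneg hL hD]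
    have e2 : ρ * (D ^ 2 * (d * max (√qmax) (d * L))) ≤ ρ * (D ^ 2 * (d ^ 2 * M')) := by gcongr
    have hAα : A ≤ α := by rw [hA]; exact div_le_self hα.le hs
    have e3 : 2 * ρ * A * (d * (2 * (d * L) * D)) * B ≤ 2 * ρ * α * (d * (2 * (d * L) * D)) * B := by
      gcongr
    have e4 : s ^ 2 * (ρ * A ^ 2 * (K * (d * (d * L)))) = ρ * α ^ 2 * K * L * d ^ 2 := by
      rw [hA]; field_simp
    rw [e4]
    linarith
  set R := L * D + ρ * (D ^ 2 * M') + 4 * ρ * α * L * D * B + ρ * α ^ 2 * K * L with hR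
  have hs2 : 1 / s ^ 2 ≤ 1 / s := one_div_le_one_div_of_le hs0 (by nlinarith)
  calc _ ≤ 4 * ρ ^ 2 * (1 / s ^ 2 * (2 * (16 / ρ * (R * d ^ 2 / (2 * ρ * A) + s ^ 2 * (d * L * μ)))
        + 5 * (D ^ 2 * (d ^ 2 * M')))) := by gcongr
    _ = 64 / α * R * (d ^ 2 / s) + 128 * ρ * L * (d ^ 2 / s)
        + 20 * ρ ^ 2 * D ^ 2 * M' * d ^ 2 * (1 / s ^ 2) := by
      rw [hA, hμ]; field_simp; ring
    _ ≤ 64 / α * R * (d ^ 2 / s) + 128 * ρ * L * (d ^ 2 / s)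
        + 20 * ρ ^ 2 * D ^ 2 * M' * d ^ 2 * (1 / s) := by gcongr
    _ = rateConst ρ L D α qmax K B * (d ^ 2 / s) := by
      rw [rateConst, ← hM', ← hR]; ring

end Rate

end Zema

end

theorem mainTheorem6
    (ρ L D β₁ β₂ β₃ r α qmax : ℝ)
    (hρ : 0 < ρ) (hL : 0 ≤ L)
    (hβ₁ : 0 ≤ β₁ ∧ β₁ < 1) (hβ₂ : 0 < β₂ ∧ β₂ < 1) (hβ₃ : 0 ≤ β₃ ∧ β₃ < 1)
    (hτ : β₁ / √β₂ < 1) (hr : 0 < r ∧ r < 1) (hα : 0 < α) :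
    ∃ C : ℝ, 0 < C ∧
      ∀ (d T : ℕ), 1 ≤ d → 1 ≤ T →
      -- the constraint set, the starting point, the initial scaling
      ∀ (X : Set (EuclideanSpace ℝ (Fin d))) (x₀ : EuclideanSpace ℝ (Fin d)) (q : Fin d → ℝ),
        IsClosed X → Convex ℝ X → x₀ ∈ X →
        (∀ x ∈ X, ∀ y ∈ X, ∀ i, |x i - y i| ≤ D) →
        (∀ i, 0 < q i ∧ q i ≤ qmax) →
      -- the objective and its stochastic zeroth-order oracle
      ∀ (Ω : Type*) [MeasurableSpace Ω] (P : MeasureTheory.Measure Ω)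
        [MeasureTheory.IsProbabilityMeasure P]
        (F : EuclideanSpace ℝ (Fin d) → Ω → ℝ) (f : EuclideanSpace ℝ (Fin d) → ℝ),
        Measurable (Function.uncurry F) →
        (∀ x, MeasureTheory.Integrable (F x) P ∧ f x = ∫ s, F x s ∂P) →
        Zema.WeaklyConvex ρ (fun i => √(q i)) f →
      -- the parameters
      ∀ (μ : ℝ) (a b : ℕ → ℝ),
        μ = d / √(T + 1) →
        (∀ t, a t = α / √(T + 1)) →
        (0 ≤ b 0 ∧ b 0 < 1) → (∀ t, 1 ≤ t → b t = β₁ * r ^ (t - 1)) →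
        (∀ s, ∀ x ∈ Metric.cthickening μ X, ∀ y ∈ Metric.cthickening μ X,
          |F x s - F y s| ≤ L * ‖x - y‖) →
      -- the random samples and the random output index
      ∀ (S : Type*) [MeasurableSpace S] (Pr : MeasureTheory.Measure S)
        [MeasureTheory.IsProbabilityMeasure Pr]
        (ξ : ℕ → S → Ω) (u : ℕ → S → EuclideanSpace ℝ (Fin d)) (tstar : S → ℕ),
        Zema.Sampling P T a Pr ξ u tstar →
      -- the output `x_{t*}`, the diagonal of `V̂_{t*}^{1/2}`, the gradient of the envelope
      ∀ (xout : S → EuclideanSpace ℝ (Fin d)) (w : S → Fin d → ℝ)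
        (grad : S → EuclideanSpace ℝ (Fin d)),
        (∀ ω, xout ω =
          Zema.iterate X F μ a b β₂ β₃ x₀ q (fun t => ξ t ω) (fun t => u t ω) (tstar ω)) →
        (∀ ω, w ω =
          Zema.scaling X F μ a b β₂ β₃ x₀ q (fun t => ξ t ω) (fun t => u t ω) (tstar ω)) →
        (∀ ω, grad ω = gradient (Zema.envelope X f (1 / (2 * ρ)) (w ω)) (xout ω)) →
        (∀ ω, DifferentiableAt ℝ (Zema.envelope X f (1 / (2 * ρ)) (w ω)) (xout ω)) ∧
        (MeasureTheory.Integrable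
            (fun ω => Zema.diagNormSq (fun i => (w ω i)⁻¹) (grad ω)) Pr ∧
          ∫ ω, Zema.diagNormSq (fun i => (w ω i)⁻¹) (grad ω) ∂Pr ≤ C * ((d : ℝ) ^ 2 / √T)) ∧
        (MeasureTheory.Integrable (fun ω => ‖grad ω‖ ^ 2) Pr ∧
          ∫ ω, ‖grad ω‖ ^ 2 ∂Pr ≤ C * max (√qmax) (d * L) * ((d : ℝ) ^ 2 / √T)) := by
  obtain ⟨hβ₁0, hβ₁1⟩ := hβ₁
  obtain ⟨hβ₂0, hβ₂1⟩ := hβ₂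
  obtain ⟨hβ₃0, hβ₃1⟩ := hβ₃
  obtain ⟨hr0, hr1⟩ := hr
  set K := 1 / ((1 - β₁ / √β₂) * √(1 - β₂)) / √(1 - β₃) with hK
  set B := 1 + β₁ / (1 - r) with hB
  have hB0 : 0 ≤ B := by
    have : 0 ≤ β₁ / (1 - r) := div_nonneg hβ₁0 (by linarith)
    linarith
  -- the absolute value covers `D < 0`, for which there is no problem instance
  set C := |Zema.rateConst ρ L D α qmax K B| + 1 with hC
  have hC0 : 0 < C := by positivity
  refine ⟨C, hC0, ?_⟩
  intro d T hd hT X x₀ q hXcl hX hx₀ hXD hq Ω _ P _ F f hF hFf hwc μ a b hμ ha hb0 hb hLip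
    S _ Pr _ ξ u tstar hsamp xout w grad hxout hw hgrad
  have hdR : (1 : ℝ) ≤ d := by exact_mod_cast hd
  have hTR : (1 : ℝ) ≤ T := by exact_mod_cast hT
  have hN0 : (0 : ℝ) < T + 1 := by linarith
  have hsN : 0 < √((T : ℝ) + 1) := Real.sqrt_pos.2 hN0
  have hμ0 : 0 < μ := by rw [hμ]; positivity
  have hD0 : 0 ≤ D := (abs_nonneg _).trans (hXD x₀ hx₀ x₀ hx₀ ⟨0, hd⟩)
  have hXc : IsCompact X := by
    refine Metric.isCompact_of_isClosed_isBounded hXcl (Metric.isBounded_iff.2 ⟨d * D, ?_⟩)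
    intro x hx y hy
    rw [dist_eq_norm]
    exact Zema.norm_le_of_abs_le hD0 fun i => hXD x hx y hy i
  have h : Zema.IsOracle P X F f ρ L μ q :=
    ⟨hX, hXc, hF, fun x => (hFf x).1, fun x => (hFf x).2, hwc, hLip, hρ, hL, hμ0, fun i => (hq i).1⟩
  set A := α / √((T : ℝ) + 1) with hA
  have hA0 : 0 < A := by positivity
  have hbt : ∀ t, 1 ≤ t → 0 ≤ b t ∧ b t ≤ β₁ := fun t ht => by
    rw [hb t ht]
    exact ⟨by positivity, mul_le_of_le_one_right hβ₁0 (pow_le_one₀ hr0.le hr1.le)⟩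
  have hbnn : ∀ t, 0 ≤ b t := fun t => by
    rcases Nat.eq_zero_or_pos t with rfl | ht
    exacts [hb0.1, (hbt t ht).1]
  have hble : ∀ t, b t ≤ 1 := fun t => by
    rcases Nat.eq_zero_or_pos t with rfl | ht
    exacts [hb0.2.le, (hbt t ht).2.trans hβ₁1.le]
  -- the samples and the states
  set Z : ℕ → S → Ω × EuclideanSpace ℝ (Fin d) := fun t ω => (ξ t ω, u t ω) with hZdef
  have hZ : ∀ t, Measurable (Z t) := fun t => (hsamp.measurable_ξ t).prodMk (hsamp.measurable_u t)
  have hZpath : Measurable fun ω t => Z t ω := measurable_pi_lambda _ hZ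
  set s : ℕ → S → Zema.State d := fun t ω =>
    Zema.stateAt X F μ a b β₂ β₃ x₀ q t fun k => Z k ω with hs
  have htraj : ∀ ω, Zema.Trajectory X A b β₂ β₃ x₀ q (fun t => s t ω)
      (fun t => Zema.estimator F μ (s t ω).x (ξ t ω) (u t ω)) := fun ω =>
    Zema.trajectory_run ha (fun t => ξ t ω) (fun t => u t ω)
  have hwpos : ∀ t ω i, 0 < (s t ω).weights i := fun t ω i =>
    (htraj ω).weights_pos hβ₃1.le h.q_pos t i
  have hxs : ∀ ω, xout ω = (s (tstar ω) ω).x := hxout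
  have hws : ∀ ω, w ω = (s (tstar ω + 1) ω).weights := hw
  have hwpos' : ∀ ω i, 0 < w ω i := fun ω i => by rw [hws]; exact hwpos _ ω i
  have hgradAt : ∀ ω, HasGradientAt (Zema.envelope X f (1 / (2 * ρ)) (w ω))
      (WithLp.toLp 2 fun i => 2 * ρ * (w ω i *
        (xout ω i - Zema.prox X f ρ (w ω) (xout ω) i))) (xout ω) := fun ω =>
    Zema.hasGradientAt_envelope hρ hwc hX hXc ⟨x₀, hx₀⟩ (fun i => (hwpos' ω i).le) (fun i => by
      rw [hws]; exact (htraj ω).le_weights hβ₃1.le _ i) _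
  have hgradEq : ∀ ω, grad ω = WithLp.toLp 2 fun i => 2 * ρ * (w ω i *
        (xout ω - Zema.prox X f ρ (w ω) (xout ω)) i) := fun ω => by
    rw [hgrad, (hgradAt ω).gradient]
    rfl
  have hdual : ∀ ω, Zema.diagNormSq (fun i => (w ω i)⁻¹) (grad ω) =
      4 * ρ ^ 2 * Zema.gap X f ρ (s (tstar ω + 1) ω).weights (s (tstar ω) ω).x := fun ω => by
    rw [hgradEq, Zema.diagNormSq_inv_toLp (hwpos' ω), hws, hxs, Zema.gap]
    ring
  -- the averaged bound
  have hsum := Zema.sum_integral_gap_le h hd hx₀ ha hA0 hD0 hXD hbnn hble (fun t ht => (hbt t ht).2)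
    hβ₁0 hβ₂0 hβ₂1 hβ₃0 hβ₃1 hτ (fun i => (hq i).2) hZ hsamp.law hsamp.indep (T + 1)
    (Zema.sum_range_momentum_le hβ₁0 hr0 hr1 hb0.2 hb T) (s := s) (fun t ω => rfl)
  -- the output index is uniform on `{0, …, T}`
  have hprob : ∀ t ∈ Finset.range (T + 1), Pr.real {ω | tstar ω = t} = 1 / (T + 1) := fun t ht => by
    rw [hsamp.law_tstar t ht]
    simp only [ha, Finset.sum_const, Finset.card_range, nsmul_eq_mul]
    push_cast
    field_simp
  have hrange : ∀ᵐ ω ∂Pr, tstar ω ∈ Finset.range (T + 1) := by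
    have hset : ∀ t, MeasurableSet {ω | tstar ω = t} := fun t =>
      hsamp.measurable_tstar (measurableSet_singleton t)
    have h1 : Pr.real (⋃ t ∈ Finset.range (T + 1), {ω | tstar ω = t}) = 1 := by
      rw [measureReal_biUnion_finset (fun i _ j _ hij => Set.disjoint_left.2 fun ω hi hj =>
        hij (hi.symm.trans hj)) (fun t _ => hset t), Finset.sum_congr rfl hprob]
      simp
      field_simp
    have h2 : Pr (⋃ t ∈ Finset.range (T + 1), {ω | tstar ω = t}) = 1 := by
      rw [measureReal_def, ENNReal.toReal_eq_one_iff] at h1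
      exact h1
    have h3 := (prob_compl_eq_zero_iff
      (Finset.measurableSet_biUnion _ fun t _ => hset t)).2 h2
    filter_upwards [measure_eq_zero_iff_ae_notMem.1 h3] with ω hω
    simpa using hω
  have havg := Zema.integral_random_index (φ := fun t z =>
      Zema.gap X f ρ (Zema.stateAt X F μ a b β₂ β₃ x₀ q (t + 1) z).weights
        (Zema.stateAt X F μ a b β₂ β₃ x₀ q t z).x) hsamp.measurable_tstar hZpath hsamp.indep_tstar
    (fun t => Zema.measurable_gap_stateAt h hx₀ ha hβ₃1.le (t + 1) t) hrange
    (fun t _ => hsum.1 t)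
  have hdualInt : Integrable (fun ω => Zema.diagNormSq (fun i => (w ω i)⁻¹) (grad ω)) Pr := by
    simp only [hdual]
    exact havg.1.const_mul _
  have hsT : 1 / √((T : ℝ) + 1) ≤ 1 / √(T : ℝ) :=
    one_div_le_one_div_of_le (Real.sqrt_pos.2 (by linarith)) (Real.sqrt_le_sqrt (by linarith))
  have hdualLe : ∫ ω, Zema.diagNormSq (fun i => (w ω i)⁻¹) (grad ω) ∂Pr ≤
      C * ((d : ℝ) ^ 2 / √T) := by
    simp only [hdual]
    rw [integral_const_mul]
    have e1 : ∫ ω, Zema.gap X f ρ (s (tstar ω + 1) ω).weights (s (tstar ω) ω).x ∂Pr =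
        1 / ((T : ℝ) + 1) * ∑ t ∈ Finset.range (T + 1),
          ∫ ω, Zema.gap X f ρ (s (t + 1) ω).weights (s t ω).x ∂Pr := by
      rw [Finset.mul_sum]
      refine havg.2.trans (Finset.sum_congr rfl fun t ht => ?_)
      rw [hprob t ht]
    have e2 := Zema.rate_arith (qmax := qmax) (K := K) hρ hL hD0 hα hB0 hdR
      (by linarith : (1 : ℝ) ≤ T + 1) hA hμ
    have e3 := hsum.2
    push_cast at e3
    rw [e1]
    calc _ ≤ _ := mul_le_mul_of_nonneg_left
          (mul_le_mul_of_nonneg_left e3 (by positivity : (0 : ℝ) ≤ 1 / ((T : ℝ) + 1)))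
          (by positivity : 0 ≤ 4 * ρ ^ 2)
      _ ≤ _ := e2
      _ ≤ C * ((d : ℝ) ^ 2 / √((T : ℝ) + 1)) := by
        refine mul_le_mul_of_nonneg_right ?_ (by positivity)
        linarith [le_abs_self (Zema.rateConst ρ L D α qmax K B)]
      _ ≤ C * ((d : ℝ) ^ 2 / √T) := by
        refine mul_le_mul_of_nonneg_left ?_ hC0.le
        rw [div_eq_mul_one_div, div_eq_mul_one_div ((d : ℝ) ^ 2)]
        exact mul_le_mul_of_nonneg_left hsT (by positivity)
  -- the Euclidean norm: the weights are almost surely at most `max (√qmax) (d L)`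
  have hnorm : ∀ᵐ ω ∂Pr, ‖grad ω‖ ^ 2 ≤
      max (√qmax) (d * L) * Zema.diagNormSq (fun i => (w ω i)⁻¹) (grad ω) := by
    filter_upwards [Zema.ae_norm_snd_le_one hZ hsamp.law] with ω hω
    refine Zema.norm_sq_le_mul_diagNormSq_inv (hwpos' ω) (fun i => ?_) _
    rw [hws]
    exact (htraj ω).weights_le hβ₂0.le hβ₂1.le hβ₃0 hβ₃1.le (fun i => (hq i).2)
      (Zema.norm_run_estimator_le h hx₀ ha (fun t => ξ t ω) hω) _ i
  have hgm : Measurable grad := by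
    have hrun := fun t => Zema.measurable_run (b := b) (β₂ := β₂) h hx₀ ha hβ₃1.le ξ u t
      (fun k _ => hsamp.measurable_ξ k) (fun k _ => hsamp.measurable_u k)
    have hx : ∀ t, Measurable fun ω => (s t ω).x := fun t => (hrun t).1
    have hv : ∀ t, Measurable fun ω => (s t ω).weights := fun t =>
      Zema.measurable_weights (hrun t).2.2.2
    have hφ : ∀ t, Measurable fun ω => (WithLp.toLp 2 fun i => 2 * ρ * ((s (t + 1) ω).weights i *
        ((s t ω).x - Zema.prox X f ρ (s (t + 1) ω).weights (s t ω).x) i) :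
          EuclideanSpace ℝ (Fin d)) := fun t => by
      have hz := (hx t).sub (Zema.measurable_prox h ⟨x₀, hx₀⟩ (hv (t + 1)) (hx t) fun ω i =>
        (htraj ω).le_weights hβ₃1.le (t + 1) i)
      refine (WithLp.measurable_toLp 2 _).comp (measurable_pi_lambda _ fun i => ?_)
      exact (((measurable_pi_apply i).comp (hv (t + 1))).mul
        ((EuclideanSpace.proj (𝕜 := ℝ) i).measurable.comp hz)).const_mul _
    have hjoint := (measurable_from_prod_countable_right (f := fun p : ℕ × S =>
      (WithLp.toLp 2 fun i => 2 * ρ * ((s (p.1 + 1) p.2).weights i *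
        ((s p.1 p.2).x - Zema.prox X f ρ (s (p.1 + 1) p.2).weights (s p.1 p.2).x) i) :
          EuclideanSpace ℝ (Fin d))) hφ).comp (hsamp.measurable_tstar.prodMk measurable_id)
    convert hjoint using 1
    funext ω
    rw [hgradEq, hws, hxs]
    rfl
  have hnormInt : Integrable (fun ω => ‖grad ω‖ ^ 2) Pr := by
    refine (hdualInt.const_mul (max (√qmax) (d * L))).mono'
      (hgm.norm.pow_const 2).aestronglyMeasurable ?_
    filter_upwards [hnorm] with ω hω
    rw [Real.norm_of_nonneg (sq_nonneg _)]
    exact hω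
  refine ⟨fun ω => (hgradAt ω).differentiableAt, ⟨hdualInt, hdualLe⟩, hnormInt, ?_⟩
  calc ∫ ω, ‖grad ω‖ ^ 2 ∂Pr ≤
      ∫ ω, max (√qmax) (d * L) * Zema.diagNormSq (fun i => (w ω i)⁻¹) (grad ω) ∂Pr :=
        integral_mono_ae hnormInt (hdualInt.const_mul _) hnorm
    _ = max (√qmax) (d * L) * ∫ ω, Zema.diagNormSq (fun i => (w ω i)⁻¹) (grad ω) ∂Pr :=
        integral_const_mul _ _
    _ ≤ max (√qmax) (d * L) * (C * ((d : ℝ) ^ 2 / √T)) :=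
        mul_le_mul_of_nonneg_left hdualLe (le_max_of_le_left (Real.sqrt_nonneg _))
    _ = C * max (√qmax) (d * L) * ((d : ℝ) ^ 2 / √T) := by ring
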